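/- A *linear space* $\Pi=(P,\mathcal L)$ is a set $P$ of points with a family $\mathcal L$ of proper subsets of $P$, called lines, such that each line contains at least two points and any two distinct points lie on exactly one line. A set $S\subset P$ is a *subspace* if it contains the line through any two of its distinct points. The subspace $\overline X$ *spanned* by $X\subset P$ is the intersection of all subspaces containing $X$. A subspace (in particular $P$, that is, $\Pi$ itself) is *$d$-dimensional* if $d+1$ is the smallest number of points spanning it. The space $\Pi$ is *projective* if in every plane (2-dimensional subspace) any two lines meet and each line has at least three points. A set $X$ is *independent* if $\overline X$ is not spanned by a proper subset of $X$, and a *base* for $\Pi$ is an independent set spanning $P$. $\mathcal G_k(\Pi)$ denotes the set of all $k$-dimensional subspaces of $\Pi$; a *base subset* of $\mathcal G_k(\Pi)$ is the set of all $k$-dimensional subspaces spanned by subsets of $B$, for some base $B$ for $\Pi$. A *collineation* is a bijection between the point sets of two such structures mapping the family of lines onto the family of lines. The *dual* $\Pi^*$ of an $n$-dimensional projective space $\Pi$ has the elements of $\mathcal G_{n-1}(\Pi)$ as points, and its lines are the sets of all $H\in\mathcal G_{n-1}(\Pi)$ containing a given $(n-2)$-dimensional subspace of $\Pi$. **Corollary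 2.1.** Let $\Pi=(P,\mathcal L)$ and $\Pi'=(P',\mathcal L')$ be projective spaces of the same finite dimension $n$, let $0<k<n-1$, and let $f:\mathcal G_k(\Pi)\to\mathcal G_k(\Pi')$ be a surjection such that $f(\mathcal B)$ is a base subset of $\mathcal G_k(\Pi')$ for every base subset $\mathcal B$ of $\mathcal G_k(\Pi)$. 1. If $n\neq 2k+1$, then $f$ is induced by a collineation of $\Pi$ to $\Pi'$; that is, there is a collineation $g$ of $\Pi$ to $\Pi'$ with $f(S)=\overline{g(S)}$ for all $S\in\mathcal G_k(\Pi)$. 2. If $n=2k+1$, then $f$ is induced by a collineation of $\Pi$ to $\Pi'$ (in the sense of 1), or by a collineation of $\Pi$ to $\Pi'^*$; the latter means that there is a collineation $g$ of $\Pi$ to $\Pi'^*$ such that, for all $S\in\mathcal G_k(\Pi)$, the subspace of $\Pi'^*$ spanned by $g(S)$ is the set $\{H\in\mathcal G_{n-1}(\Pi') : f(S)\subset H\}$. -/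

import Mathlib

/-- A set of points `P` together with a family of subsets of `P`, called lines. -/
structure PointLineSpace (P : Type*) where
  lines : Set (Set P)

namespace PointLineSpace

/-- The axioms of a linear space: lines are proper subsets of the point set, each line has at
least two points, and two distinct points lie on exactly one common line. -/
structure IsLinearSpace {P : Type*} (G : PointLineSpace P) : Prop where
  line_ne_univ : ∀ L ∈ G.lines, L ≠ Set.univ
  line_nontrivial : ∀ L ∈ G.lines, L.Nontrivial
  existsUnique_line : ∀ p q : P, p ≠ q → ∃! L : Set P, L ∈ G.lines ∧ p ∈ L ∧ q ∈ L

/-- A subspace contains the line through any two of its distinct points. -/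
def IsSubspace {P : Type*} (G : PointLineSpace P) (S : Set P) : Prop :=
  ∀ p ∈ S, ∀ q ∈ S, p ≠ q → ∀ L ∈ G.lines, p ∈ L → q ∈ L → L ⊆ S

/-- The subspace spanned by a set of points. -/
def span {P : Type*} (G : PointLineSpace P) (X : Set P) : Set P :=
  ⋂₀ {S : Set P | G.IsSubspace S ∧ X ⊆ S}

/-- `S` is a `d`-dimensional subspace: the smallest number of points spanning it is `d + 1`. -/
def HasDim {P : Type*} (G : PointLineSpace P) (S : Set P) (d : ℕ) : Prop :=
  G.IsSubspace S ∧ IsLeast {m : ℕ | ∃ X : Finset P, X.card = m ∧ G.span (X : Set P) = S} (d + 1)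

/-- A projective space: a linear space in which, in every plane (two-dimensional subspace), any
two lines meet and each line has at least three points. -/
def IsProjective {P : Type*} (G : PointLineSpace P) : Prop :=
  G.IsLinearSpace ∧ ∀ S : Set P, G.HasDim S 2 →
    (∀ L ∈ G.lines, ∀ M ∈ G.lines, L ⊆ S → M ⊆ S → (L ∩ M).Nonempty) ∧
    (∀ L ∈ G.lines, L ⊆ S → 3 ≤ L.encard)

/-- `X` is independent: the subspace spanned by `X` is not spanned by a proper subset of `X`. -/
def IsIndependent {P : Type*} (G : PointLineSpace P) (X : Set P) : Prop :=
  ∀ Y : Set P, Y ⊂ X → G.span Y ≠ G.span X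

/-- A base for the whole space: an independent set of points spanning it. -/
def IsBase {P : Type*} (G : PointLineSpace P) (B : Set P) : Prop :=
  G.IsIndependent B ∧ G.span B = Set.univ

/-- The Grassmann space of all `k`-dimensional subspaces. -/
def grassmann {P : Type*} (G : PointLineSpace P) (k : ℕ) : Set (Set P) :=
  {S : Set P | G.HasDim S k}

/-- A base subset of the Grassmann space: all `k`-dimensional subspaces spanned by points of some
base `B`. -/
def IsBaseSubset {P : Type*} (G : PointLineSpace P) (k : ℕ) (𝓑 : Set (G.grassmann k)) : Prop :=
  ∃ B : Set P, G.IsBase B ∧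
    𝓑 = {S : G.grassmann k | ∃ X : Set P, X ⊆ B ∧ G.span X = (S : Set P)}

/-- A collineation: a bijection of the points that maps the family of lines onto the family of
lines. -/
def IsCollineation {P P' : Type*} (G : PointLineSpace P) (G' : PointLineSpace P')
    (g : P → P') : Prop :=
  Function.Bijective g ∧ (fun L : Set P => g '' L) '' G.lines = G'.lines

/-- The set of all hyperplanes, of an `n`-dimensional space, that contain the set `U`. -/
def hyperplanesThrough {P : Type*} (G : PointLineSpace P) (n : ℕ) (U : Set P) :
    Set (G.grassmann (n - 1)) :=
  {H : G.grassmann (n - 1) | U ⊆ (H : Set P)}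

/-- The dual of an `n`-dimensional projective space (`2 ≤ n`): its points are the
`(n - 1)`-dimensional subspaces, and a line consists of all of those that contain a given
`(n - 2)`-dimensional subspace. -/
def dual {P : Type*} (G : PointLineSpace P) (n : ℕ) : PointLineSpace (G.grassmann (n - 1)) where
  lines := {l | ∃ U : Set P, G.HasDim U (n - 2) ∧ l = G.hyperplanesThrough n U}

/-- `f` is induced by the map `g` of points: `f` sends `S` to the subspace spanned by `g(S)`. -/
def IsInducedBy {P P' : Type*} (G : PointLineSpace P) (G' : PointLineSpace P') (k : ℕ)
    (f : G.grassmann k → G'.grassmann k) (g : P → P') : Prop :=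
  ∀ S : G.grassmann k, ((f S : G'.grassmann k) : Set P') = G'.span (g '' (S : Set P))

/-- `f` is induced by the map `g` to the points of the dual space (used for `n = 2 * k + 1`): the
subspace of the dual space spanned by `g(S)` is the one identified with `f S`, namely the set of
all hyperplanes containing `f S`. -/
def IsInducedByDual {P P' : Type*} (G : PointLineSpace P) (G' : PointLineSpace P') (n k : ℕ)
    (f : G.grassmann k → G'.grassmann k) (g : P → G'.grassmann (n - 1)) : Prop :=
  ∀ S : G.grassmann k,
    (G'.dual n).span (g '' (S : Set P)) = G'.hyperplanesThrough n ((f S : G'.grassmann k) : Set P')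

end PointLineSpace

/-!
A map `f` as in the theorem is an isomorphism of Grassmann graphs, so that Chow's theorem applies.

*From base subsets to adjacency.* Any two subspaces are spanned by parts of a common base, and all
base subsets have the same finite size, so `f` is injective. Call a part `R` of the base subset
of `B` inexact if a second base subset contains it. By injectivity `f` maps inexact sets to inexact
sets. If `R` separates the points of `B`, that is, if for all `p ≠ q` in `B` some member of `R`
contains `p` but not `q`, then every point of `B` is an intersection of members of `R` and `R` is
not inexact (`subset_of_separating`). If instead no member of `R` separates `p` from `q`, then `p`
can be replaced by a third point of the line `pq`, and `R` is inexact
(`exists_base_of_not_separating`). So the maximal inexact sets are the complements of the sets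
`sepSubset G k B p q`; these all have the same size, and `f` maps them onto each other. The number
of pairs `(p, q)` separated by both `S` and `T` is `m * (N + m - 2 * (k + 1))` with `N = n + 1` and
`m` the rank of `S ∩ T`; among distinct `S` and `T` it is largest exactly when they are adjacent
(`rank_inter_eq_iff`).

*Chow's theorem* is proved for lattices with a rank function (`IsGeometricRank`), a notion closed
under order duality. The maximal cliques of a Grassmann graph are the stars and the tops, and by
connectedness an isomorphism maps all stars to stars or all stars to tops; the second case is the
first one for the dual lattice. An isomorphism mapping stars to stars induces one of the Grassmann
graphs one rank lower. The descent ends at points and lines, and it ends simultaneously on both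
sides because only the extreme Grassmann graphs are complete; this forces `n = 2 * k + 1` in the
second case.

*Geometry.* The axiom that coplanar lines meet is used as associativity of the join of points
(`exists_mem_span_pair_assoc`). It makes the span the closure operator of a matroid, and makes the
rank function on the lattice of subspaces modular.
-/

/-! ### Rank functions of projective geometries -/

/-- `r` is the rank function of a projective geometry of rank `N` on the bounded lattice `L` (of
its subspaces): strictly monotone and modular, with all intermediate ranks attained and with
relative complements. Points have rank `1`, so the rank exceeds the projective dimension by one.
The notion is self-dual. -/
structure IsGeometricRank {L : Type*} [Lattice L] [BoundedOrder L] (r : L → ℕ) (N : ℕ) :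
    Prop where
  strictMono : StrictMono r
  sup_add_inf : ∀ x y, r (x ⊔ y) + r (x ⊓ y) = r x + r y
  rank_bot : r ⊥ = 0
  rank_top : r ⊤ = N
  exists_between : ∀ (x y : L) (j : ℕ), x ≤ y → r x ≤ j → j ≤ r y → ∃ z, x ≤ z ∧ z ≤ y ∧ r z = j
  exists_relCompl : ∀ u v w : L, u ≤ v → v ≤ w → ∃ c, v ⊓ c = u ∧ v ⊔ c = w

namespace IsGeometricRank

variable {L : Type*} [Lattice L] [BoundedOrder L] {r : L → ℕ} {N : ℕ}

lemma mono (h : IsGeometricRank r N) {x y : L} (hxy : x ≤ y) : r x ≤ r y :=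
  h.strictMono.monotone hxy

lemma le_rank_top (h : IsGeometricRank r N) (x : L) : r x ≤ N :=
  h.rank_top ▸ h.mono le_top

lemma eq_of_le (h : IsGeometricRank r N) {x y : L} (hxy : x ≤ y) (hr : r y ≤ r x) : x = y := by
  by_contra hne
  exact absurd (h.strictMono (lt_of_le_of_ne hxy hne)) (not_lt.2 hr)

/-- The order dual carries the corank as a rank function. -/
lemma dual (h : IsGeometricRank r N) :
    IsGeometricRank (fun x : Lᵒᵈ => N - r (OrderDual.ofDual x)) N where
  strictMono x y hxy := by
    have h1 := h.strictMono (OrderDual.ofDual_lt_ofDual.2 hxy)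
    have h2 := h.le_rank_top (OrderDual.ofDual x)
    dsimp only
    omega
  sup_add_inf x y := by
    have h1 := h.sup_add_inf (OrderDual.ofDual x) (OrderDual.ofDual y)
    have h2 := h.le_rank_top (OrderDual.ofDual x ⊔ OrderDual.ofDual y)
    have h3 := h.mono (inf_le_left : OrderDual.ofDual x ⊓ OrderDual.ofDual y ≤ OrderDual.ofDual x)
    have h4 := h.mono (le_sup_left : OrderDual.ofDual x ≤ OrderDual.ofDual x ⊔ OrderDual.ofDual y)
    have h5 := h.mono (le_sup_right : OrderDual.ofDual y ≤ OrderDual.ofDual x ⊔ OrderDual.ofDual y)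
    simp only [ofDual_sup, ofDual_inf]
    omega
  rank_bot := by simp [h.rank_top]
  rank_top := by simp [h.rank_bot]
  exists_between x y j hxy hx hy := by
    have h1 := h.le_rank_top (OrderDual.ofDual x)
    have h2 := h.le_rank_top (OrderDual.ofDual y)
    obtain ⟨z, hz1, hz2, hz⟩ := h.exists_between (OrderDual.ofDual y) (OrderDual.ofDual x) (N - j)
      hxy (by omega) (by omega)
    refine ⟨OrderDual.toDual z, hz2, hz1, ?_⟩
    simp only [OrderDual.ofDual_toDual]
    omega
  exists_relCompl u v w huv hvw := by
    obtain ⟨c, hc1, hc2⟩ := h.exists_relCompl (OrderDual.ofDual w) (OrderDual.ofDual v)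
      (OrderDual.ofDual u) hvw huv
    exact ⟨OrderDual.toDual c, hc2, hc1⟩

/-- An element strictly inside an interval of length two has a relative complement of the same
rank. -/
lemma exists_ne_between (h : IsGeometricRank r N) {u x v : L} (hux : u ≤ x) (hxv : x ≤ v)
    (h1 : r u + 1 = r x) (h2 : r x + 1 = r v) :
    ∃ c, u ≤ c ∧ c ≤ v ∧ r c = r x ∧ x ⊓ c = u ∧ x ⊔ c = v := by
  obtain ⟨c, hc1, hc2⟩ := h.exists_relCompl u x v hux hxv
  have := h.sup_add_inf x c
  rw [hc1, hc2] at this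
  exact ⟨c, hc1 ▸ inf_le_right, hc2 ▸ le_sup_right, by omega, hc1, hc2⟩

lemma exists_ge_not_le (h : IsGeometricRank r N) {u v : L} (hv : r v < N) (hu : r u < N) :
    ∃ x, r x = r u + 1 ∧ u ≤ x ∧ ¬ x ≤ v := by
  by_cases huv : u ≤ v
  · obtain ⟨c, hc1, hc2⟩ := h.exists_relCompl u v ⊤ huv le_top
    have hs := h.sup_add_inf v c
    rw [hc1, hc2, h.rank_top] at hs
    obtain ⟨x, hx1, hx2, hx⟩ := h.exists_between u c (r u + 1) (hc1 ▸ inf_le_right)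
      (by omega) (by omega)
    refine ⟨x, hx, hx1, fun hxv => ?_⟩
    have := h.mono (le_inf hxv hx2)
    rw [hc1] at this
    omega
  · obtain ⟨x, hx1, -, hx⟩ := h.exists_between u ⊤ (r u + 1) le_top (by omega)
      (by rw [h.rank_top]; omega)
    exact ⟨x, hx, hx1, fun hxv => huv (hx1.trans hxv)⟩

end IsGeometricRank

/-! ### Grassmann graphs and their maximal cliques -/

/-- The elements of rank `m`. -/
abbrev RankLevel {L : Type*} (r : L → ℕ) (m : ℕ) := {x : L // r x = m}

/-- The Grassmann graph on the elements of rank `m`: two of them are adjacent if their join has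
rank `m + 1`. -/
def grassmannGraph {L : Type*} [Lattice L] (r : L → ℕ) (m : ℕ) :
    SimpleGraph (RankLevel r m) where
  Adj x y := r (x ⊔ y : L) = m + 1
  symm := ⟨fun x y h => by rwa [sup_comm]⟩
  loopless := ⟨fun x h => by simp [x.2] at h⟩

/-- The star of `u`: the elements of rank `m` above `u`. -/
def grassmannStar {L : Type*} [Lattice L] (r : L → ℕ) (m : ℕ) (u : L) : Set (RankLevel r m) :=
  {x | u ≤ x}

/-- The top of `v`: the elements of rank `m` below `v`. -/
def grassmannTop {L : Type*} [Lattice L] (r : L → ℕ) (m : ℕ) (v : L) : Set (RankLevel r m) :=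
  {x | (x : L) ≤ v}

namespace IsGeometricRank

variable {L : Type*} [Lattice L] [BoundedOrder L] {r : L → ℕ} {N m : ℕ}

lemma adj_iff_rank_inf (h : IsGeometricRank r N) {x y : RankLevel r m} :
    (grassmannGraph r m).Adj x y ↔ r (x ⊓ y : L) + 1 = m := by
  have h1 := h.sup_add_inf x y
  have h2 := x.2
  have h3 := y.2
  change r (x ⊔ y : L) = m + 1 ↔ _
  omega

lemma inf_rank_lt (h : IsGeometricRank r N) {x y : RankLevel r m} (hne : x ≠ y) :
    r (x ⊓ y : L) < m := by
  by_contra hlt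
  have h1 := h.eq_of_le (inf_le_left : (x ⊓ y : L) ≤ x) (by rw [x.2]; omega)
  have h2 := h.eq_of_le (inf_le_right : (x ⊓ y : L) ≤ y) (by rw [y.2]; omega)
  exact hne (Subtype.ext (h1.symm.trans h2))

lemma adj_of_mem_star (h : IsGeometricRank r N) {u : L} (hu : r u + 1 = m)
    {x y : RankLevel r m} (hx : u ≤ x) (hy : u ≤ y) (hne : x ≠ y) :
    (grassmannGraph r m).Adj x y := by
  rw [h.adj_iff_rank_inf]
  have h1 := h.inf_rank_lt hne
  have h2 := h.mono (le_inf hx hy)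
  omega

lemma adj_of_mem_top (h : IsGeometricRank r N) {v : L} (hv : r v = m + 1)
    {x y : RankLevel r m} (hx : (x : L) ≤ v) (hy : (y : L) ≤ v) (hne : x ≠ y) :
    (grassmannGraph r m).Adj x y := by
  change r (x ⊔ y : L) = m + 1
  have h1 := h.inf_rank_lt hne
  have h2 := h.mono (sup_le hx hy)
  have h3 := h.sup_add_inf x y
  have h4 := x.2
  have h5 := y.2
  omega

lemma inf_le_or_le_sup (h : IsGeometricRank r N) {x y z : RankLevel r m}
    (hxy : (grassmannGraph r m).Adj x y) (hzx : (grassmannGraph r m).Adj z x)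
    (hzy : (grassmannGraph r m).Adj z y) : (x ⊓ y : L) ≤ z ∨ (z : L) ≤ (x ⊔ y : L) := by
  by_contra! ⟨h1, h2⟩
  rw [h.adj_iff_rank_inf] at hxy hzx hzy
  have hne : ¬ (z ⊓ y : L) ≤ (z ⊓ x : L) := by
    intro hle
    have : (z ⊓ y : L) = (x ⊓ y : L) :=
      h.eq_of_le (le_inf (hle.trans inf_le_right) inf_le_right) (by omega)
    exact h1 (this ▸ inf_le_left)
  have h3 : r (z ⊓ x : L) < r ((z ⊓ x) ⊔ (z ⊓ y) : L) := h.strictMono (left_lt_sup.2 hne)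
  have h4 : ((z ⊓ x) ⊔ (z ⊓ y) : L) = z :=
    h.eq_of_le (sup_le inf_le_left inf_le_left) (by have := z.2; omega)
  exact h2 (h4 ▸ sup_le_sup inf_le_right inf_le_right)

lemma not_adj_of_star_of_top (h : IsGeometricRank r N) {u v : L} (hu : r u + 1 = m)
    (huv : u ≤ v) {z w : RankLevel r m} (huz : u ≤ z) (hzv : ¬ (z : L) ≤ v)
    (hwv : (w : L) ≤ v) (huw : ¬ u ≤ w) : ¬ (grassmannGraph r m).Adj z w := by
  rw [h.adj_iff_rank_inf]
  intro hadj
  have h1 : r (z ⊓ v : L) < r (z : L) := h.strictMono (inf_lt_left.2 hzv)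
  have h2 : u = (z ⊓ v : L) := h.eq_of_le (le_inf huz huv) (by have := z.2; omega)
  have h3 : (z ⊓ w : L) = u := h.eq_of_le (h2 ▸ inf_le_inf_left _ hwv) (by omega)
  exact huw (h3 ▸ inf_le_right)

/-- Every maximal clique of a Grassmann graph is a star or a top. -/
lemma star_or_top_of_maximal (h : IsGeometricRank r N) (hm : 1 ≤ m) (hmN : m + 1 ≤ N)
    {s : Set (RankLevel r m)} (hs : Maximal (grassmannGraph r m).IsClique s) :
    (∃ u, r u + 1 = m ∧ s = grassmannStar r m u) ∨
      (∃ v, r v = m + 1 ∧ s = grassmannTop r m v) := by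
  have hne : s.Nonempty := by
    obtain ⟨x, -, -, hx⟩ := h.exists_between ⊥ ⊤ m bot_le (by rw [h.rank_bot]; omega)
      (by rw [h.rank_top]; omega)
    rw [Set.nonempty_iff_ne_empty]
    intro he
    have := hs.2 (y := {⟨x, hx⟩}) (by simp) (by simp [he])
    simp [he] at this
  obtain ⟨x, hx⟩ := hne
  have hy : ∃ y ∈ s, y ≠ x := by
    by_contra! hall
    obtain ⟨u, -, hux, hu⟩ := h.exists_between ⊥ x (m - 1) bot_le (by rw [h.rank_bot]; omega)
      (by rw [x.2]; omega)
    obtain ⟨v, hxv, -, hv⟩ := h.exists_between x ⊤ (m + 1) le_top (by rw [x.2]; omega)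
      (by rw [h.rank_top]; omega)
    obtain ⟨c, -, -, hc, -, hcv⟩ := h.exists_ne_between hux hxv (by rw [x.2]; omega)
      (by rw [x.2, hv])
    have hadj : (grassmannGraph r m).Adj x ⟨c, hc.trans x.2⟩ := by
      change r (x ⊔ c : L) = m + 1
      rw [hcv, hv]
    have hcl : (grassmannGraph r m).IsClique {x, ⟨c, hc.trans x.2⟩} := by
      rw [SimpleGraph.isClique_pair]
      exact fun _ => hadj
    have := hs.2 hcl (fun z hz => Or.inl (hall z hz)) (Or.inr rfl)
    exact hadj.ne (hall _ this).symm
  obtain ⟨y, hy, hyx⟩ := hy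
  have hadj : (grassmannGraph r m).Adj x y := hs.1 hx hy hyx.symm
  have hu := h.adj_iff_rank_inf.1 hadj
  have hv : r (x ⊔ y : L) = m + 1 := hadj
  have hor : ∀ z ∈ s, (x ⊓ y : L) ≤ z ∨ (z : L) ≤ (x ⊔ y : L) := by
    intro z hz
    by_cases hzx : z = x
    · exact Or.inl (hzx ▸ inf_le_left)
    by_cases hzy : z = y
    · exact Or.inl (hzy ▸ inf_le_right)
    exact h.inf_le_or_le_sup hadj (hs.1 hz hx hzx) (hs.1 hz hy hzy)
  by_cases hall : ∀ z ∈ s, (x ⊓ y : L) ≤ z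
  · refine Or.inl ⟨_, hu, (hs.eq_of_subset ?_ hall)⟩
    exact fun a ha b hb hab => h.adj_of_mem_star hu ha hb hab
  · push Not at hall
    obtain ⟨w, hw, huw⟩ := hall
    refine Or.inr ⟨_, hv, (hs.eq_of_subset ?_ ?_)⟩
    · exact fun a ha b hb hab => h.adj_of_mem_top hv ha hb hab
    · intro z hz
      by_contra hzv
      have huz := (hor z hz).resolve_right hzv
      refine h.not_adj_of_star_of_top hu (inf_le_left.trans le_sup_left) huz hzv
        ((hor w hw).resolve_left huw) huw (hs.1 hz hw ?_)
      rintro rfl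
      exact huw huz

lemma maximal_star (h : IsGeometricRank r N) (hmN : m + 2 ≤ N) {u : L} (hu : r u + 1 = m) :
    Maximal (grassmannGraph r m).IsClique (grassmannStar r m u) := by
  refine ⟨fun a ha b hb hab => h.adj_of_mem_star hu ha hb hab, fun t ht hst z hz => ?_⟩
  by_contra huz
  have key : ∀ x : RankLevel r m, u ≤ x → r (z ⊔ u : L) = m + 1 ∧ (x : L) ≤ (z ⊔ u : L) := by
    intro x hx
    have hadj : r (z ⊔ x : L) = m + 1 := ht hz (hst hx) (by rintro rfl; exact huz hx)
    have h1 : r (z : L) < r (z ⊔ u : L) := h.strictMono (left_lt_sup.2 huz)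
    have h2 : (z ⊔ u : L) = (z ⊔ x : L) :=
      h.eq_of_le (sup_le_sup_left hx _) (by have := z.2; omega)
    exact ⟨h2 ▸ hadj, h2 ▸ le_sup_right⟩
  obtain ⟨x, hux, -, hx⟩ := h.exists_between u ⊤ m le_top (by omega) (by rw [h.rank_top]; omega)
  have h1 := (key ⟨x, hx⟩ hux).1
  obtain ⟨y, hy, huy, hyv⟩ := h.exists_ge_not_le (u := u) (v := (z ⊔ u : L)) (by omega) (by omega)
  exact hyv (key ⟨y, hy.trans hu⟩ huy).2

lemma star_ne_top (h : IsGeometricRank r N) (hmN : m + 2 ≤ N) {u v : L} (hu : r u + 1 = m)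
    (hv : r v = m + 1) : grassmannStar r m u ≠ grassmannTop r m v := by
  intro he
  obtain ⟨x, hx, hux, hxv⟩ := h.exists_ge_not_le (u := u) (v := v) (by omega) (by omega)
  have : (⟨x, hx.trans hu⟩ : RankLevel r m) ∈ grassmannStar r m u := hux
  rw [he] at this
  exact hxv this

lemma le_of_star_eq (h : IsGeometricRank r N) (hmN : m + 1 ≤ N) {u u' : L} (hu : r u + 1 = m)
    (he : grassmannStar r m u = grassmannStar r m u') : u' ≤ u := by
  obtain ⟨x, hux, -, hx⟩ := h.exists_between u ⊤ m le_top (by omega) (by rw [h.rank_top]; omega)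
  obtain ⟨y, hy, huy, hyx⟩ := h.exists_ge_not_le (u := u) (v := x) (by omega) (by omega)
  have h1 : (⟨x, hx⟩ : RankLevel r m) ∈ grassmannStar r m u' := he ▸ hux
  have h2 : (⟨y, hy.trans hu⟩ : RankLevel r m) ∈ grassmannStar r m u' := he ▸ huy
  have h3 : r (y ⊓ x) < r y := h.strictMono (inf_lt_left.2 hyx)
  have h4 : u = y ⊓ x := h.eq_of_le (le_inf huy hux) (by omega)
  rw [h4]
  exact le_inf h2 h1

lemma star_injective (h : IsGeometricRank r N) (hmN : m + 1 ≤ N) {u u' : L} (hu : r u + 1 = m)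
    (hu' : r u' + 1 = m) (he : grassmannStar r m u = grassmannStar r m u') : u = u' :=
  le_antisymm (h.le_of_star_eq hmN hu' he.symm) (h.le_of_star_eq hmN hu he)

/-- Any two elements of rank `j` are joined by a path in the Grassmann graph. -/
lemma induction_adj (h : IsGeometricRank r N) {j : ℕ} (Q : L → Prop)
    (hQ : ∀ u w, r u = j → r w = j → r (u ⊔ w) = j + 1 → Q u → Q w)
    {u w : L} (hu : r u = j) (hw : r w = j) (hQu : Q u) : Q w := by
  induction hd : j - r (u ⊓ w) using Nat.strong_induction_on generalizing u with
  | _ d ih =>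
  rcases Nat.eq_zero_or_pos d with rfl | hpos
  · have h1 := h.eq_of_le (inf_le_left : u ⊓ w ≤ u) (by omega)
    have h2 := h.eq_of_le (inf_le_right : u ⊓ w ≤ w) (by omega)
    exact (h1.symm.trans h2) ▸ hQu
  -- Exchange one dimension of `u` for one dimension of `w` outside `u ⊓ w`.
  obtain ⟨a, hta, haw, ha⟩ := h.exists_between (u ⊓ w) w (r (u ⊓ w) + 1) inf_le_right
    (by omega) (by omega)
  obtain ⟨b, htb, hbu, hb⟩ := h.exists_between (u ⊓ w) u (j - 1) inf_le_left
    (by omega) (by omega)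
  have hab : b ⊓ a = u ⊓ w := le_antisymm (inf_le_inf hbu haw) (le_inf htb hta)
  have hua : u ⊓ a = u ⊓ w := le_antisymm (inf_le_inf_left _ haw) (le_inf inf_le_left hta)
  have h1 := h.sup_add_inf b a
  have h2 := h.sup_add_inf u a
  rw [hab] at h1
  rw [hua] at h2
  have hsup : u ⊔ (b ⊔ a) = u ⊔ a := by rw [← sup_assoc, sup_eq_left.2 hbu]
  have h3 := h.mono (le_inf (le_sup_right : a ≤ b ⊔ a) haw)
  exact ih (j - r ((b ⊔ a) ⊓ w)) (by omega) (by omega)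
    (hQ u _ hu (by omega) (by rw [hsup]; omega) hQu) rfl

lemma exists_not_adj (h : IsGeometricRank r N) (hm : 2 ≤ m) (hmN : m + 2 ≤ N) :
    ∃ x y : RankLevel r m, x ≠ y ∧ ¬ (grassmannGraph r m).Adj x y := by
  obtain ⟨x, -, -, hx⟩ := h.exists_between ⊥ ⊤ m bot_le (by rw [h.rank_bot]; omega)
      (by rw [h.rank_top]; omega)
  obtain ⟨u, -, hux, hu⟩ := h.exists_between ⊥ x (m - 2) bot_le (by rw [h.rank_bot]; omega)
    (by omega)
  obtain ⟨v, hxv, -, hv⟩ := h.exists_between x ⊤ (m + 2) le_top (by omega)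
    (by rw [h.rank_top]; omega)
  obtain ⟨c, hc1, hc2⟩ := h.exists_relCompl u x v hux hxv
  have hs := h.sup_add_inf x c
  rw [hc1, hc2] at hs
  refine ⟨⟨x, hx⟩, ⟨c, by omega⟩, ?_, ?_⟩
  · intro he
    have he : x = c := congrArg Subtype.val he
    rw [← he, inf_idem] at hc1
    subst hc1
    omega
  · change ¬ r (x ⊔ c) = m + 1
    rw [hc2]
    omega

lemma adj_of_rank_one (h : IsGeometricRank r N) {x y : RankLevel r 1} (hne : x ≠ y) :
    (grassmannGraph r 1).Adj x y := by
  rw [h.adj_iff_rank_inf]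
  have := h.inf_rank_lt hne
  omega

lemma adj_iff_exists_ge (h : IsGeometricRank r N) {x y : RankLevel r m} :
    (grassmannGraph r m).Adj x y ↔ x ≠ y ∧ ∃ z : RankLevel r (m + 1), (x : L) ≤ z ∧ (y : L) ≤ z :=
  ⟨fun hadj => ⟨hadj.ne, ⟨_, hadj⟩, le_sup_left, le_sup_right⟩,
    fun ⟨hne, z, hx, hy⟩ => h.adj_of_mem_top z.2 hx hy hne⟩

end IsGeometricRank

lemma SimpleGraph.Iso.isClique_image {V W : Type*} {G : SimpleGraph V} {H : SimpleGraph W}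
    (f : G ≃g H) {s : Set V} (hs : G.IsClique s) : H.IsClique (f '' s) := by
  rintro _ ⟨x, hx, rfl⟩ _ ⟨y, hy, rfl⟩ hne
  exact f.map_adj_iff.2 (hs hx hy (fun he => hne (he ▸ rfl)))

lemma SimpleGraph.Iso.maximal_isClique_image {V W : Type*} {G : SimpleGraph V} {H : SimpleGraph W}
    (f : G ≃g H) {s : Set V} (hs : Maximal G.IsClique s) : Maximal H.IsClique (f '' s) := by
  refine ⟨f.isClique_image hs.1, fun t ht hst y hy => ?_⟩
  have h1 : f.symm '' t ⊆ s := hs.2 (f.symm.isClique_image ht) (fun x hx =>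
    ⟨f x, hst ⟨x, hx, rfl⟩, f.symm_apply_apply x⟩)
  exact ⟨f.symm y, h1 ⟨y, hy, rfl⟩, f.apply_symm_apply y⟩

/-! ### Isomorphisms of Grassmann graphs -/

section GrassmannIso

variable {L : Type*} [Lattice L] [BoundedOrder L] {r : L → ℕ} {N : ℕ}
  {L' : Type*} [Lattice L'] [BoundedOrder L'] {r' : L' → ℕ} {N' : ℕ} {m m' a a' : ℕ}

/-- The isomorphism `f` of Grassmann graphs maps every star onto a star. -/
def MapsStarsToStars (f : grassmannGraph r m ≃g grassmannGraph r' m') : Prop :=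
  ∀ u, r u + 1 = m → ∃ u', r' u' + 1 = m' ∧ f '' grassmannStar r m u = grassmannStar r' m' u'

/-- Stars of adjacent elements meet in a single element, whereas a star and a top meet in none or
in several. By connectedness, stars are therefore all mapped to stars or all mapped to tops. -/
lemma mapsStarsToStars_or_tops (h : IsGeometricRank r N) (h' : IsGeometricRank r' N')
    (hmN : m + 2 ≤ N) (hm' : 1 ≤ m') (hmN' : m' + 2 ≤ N')
    (f : grassmannGraph r m ≃g grassmannGraph r' m') :
    MapsStarsToStars f ∨ ∀ u, r u + 1 = m →
      ∃ v', r' v' = m' + 1 ∧ f '' grassmannStar r m u = grassmannTop r' m' v' := by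
  have htype : ∀ u, r u + 1 = m → _ := fun u hu => h'.star_or_top_of_maximal hm' (by omega)
    (f.maximal_isClique_image (h.maximal_star hmN hu))
  by_cases hex : ∃ u₀, r u₀ + 1 = m ∧ ∃ u', r' u' + 1 = m' ∧
      f '' grassmannStar r m u₀ = grassmannStar r' m' u'
  · left
    obtain ⟨u₀, hu₀, hQ₀⟩ := hex
    intro w hw
    refine h.induction_adj (j := m - 1) (Q := fun u => ∃ u', r' u' + 1 = m' ∧
      f '' grassmannStar r m u = grassmannStar r' m' u') ?_ (by omega) (by omega) hQ₀
    intro u w hu hw huw ⟨u', hu', hfu⟩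
    refine (htype w (by omega)).resolve_right ?_
    rintro ⟨v', hv', hfw⟩
    set x : RankLevel r m := ⟨u ⊔ w, by omega⟩ with hx
    have hx1 : u' ≤ f x := by
      change f x ∈ grassmannStar r' m' u'
      exact hfu ▸ ⟨x, (le_sup_left : u ≤ u ⊔ w), rfl⟩
    have hx2 : (f x : L') ≤ v' := by
      change f x ∈ grassmannTop r' m' v'
      exact hfw ▸ ⟨x, (le_sup_right : w ≤ u ⊔ w), rfl⟩
    obtain ⟨c, huc, hcv, hc, hc1, -⟩ := h'.exists_ne_between hx1 hx2 (by rw [(f x).2]; exact hu')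
      (by rw [(f x).2, hv'])
    obtain ⟨y, hy, hyc⟩ : (⟨c, hc.trans (f x).2⟩ : RankLevel r' m') ∈
        f '' grassmannStar r m u := hfu ▸ huc
    obtain ⟨z, hz, hzc⟩ : (⟨c, hc.trans (f x).2⟩ : RankLevel r' m') ∈
        f '' grassmannStar r m w := hfw ▸ hcv
    obtain rfl : y = z := f.injective (hyc.trans hzc.symm)
    have hxy : x = y := Subtype.ext (h.eq_of_le (sup_le hy hz) (by have := x.2; have := y.2; omega))
    rw [← hxy] at hyc
    rw [show c = f x from (congrArg Subtype.val hyc).symm, inf_idem] at hc1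
    rw [← hc1, (f x).2] at hu'
    omega
  · right
    intro u hu
    exact (htype u hu).resolve_left fun hst => hex ⟨u, hu, hst⟩

namespace MapsStarsToStars

lemma symm (h : IsGeometricRank r N) (h' : IsGeometricRank r' N')
    (hm : 1 ≤ m) (hmN : m + 2 ≤ N) (hmN' : m' + 2 ≤ N')
    {f : grassmannGraph r m ≃g grassmannGraph r' m'} (hf : MapsStarsToStars f) :
    MapsStarsToStars f.symm := by
  intro u' hu'
  refine (h.star_or_top_of_maximal hm (by omega)
    (f.symm.maximal_isClique_image (h'.maximal_star hmN' hu'))).resolve_right ?_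
  rintro ⟨v, hv, hfv⟩
  have hfv' : grassmannStar r' m' u' = f '' grassmannTop r m v := by
    rw [← hfv, Set.image_image]
    simp
  obtain ⟨u, -, huv, hu⟩ := h.exists_between ⊥ v (m - 1) bot_le (by rw [h.rank_bot]; omega)
    (by omega)
  obtain ⟨x, hux, hxv, hx⟩ := h.exists_between u v m huv (by omega) (by omega)
  obtain ⟨c, huc, hcv, hc, hc1, -⟩ := h.exists_ne_between hux hxv (by omega) (by omega)
  obtain ⟨u'', hu'', hfu⟩ := hf u (by omega)
  have hmem : ∀ z (hz : r z = m), u ≤ z → z ≤ v →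
      u' ≤ f ⟨z, hz⟩ ∧ u'' ≤ f ⟨z, hz⟩ := by
    intro z hz huz hzv
    constructor
    · change f ⟨z, hz⟩ ∈ grassmannStar r' m' u'
      exact hfv' ▸ ⟨⟨z, hz⟩, hzv, rfl⟩
    · change f ⟨z, hz⟩ ∈ grassmannStar r' m' u''
      exact hfu ▸ ⟨⟨z, hz⟩, huz, rfl⟩
  have hne : f ⟨x, hx⟩ ≠ f ⟨c, hc.trans hx⟩ := by
    intro he
    have he : x = c := congrArg Subtype.val (f.injective he)
    rw [← he, inf_idem] at hc1
    subst hc1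
    omega
  have hlt := h'.inf_rank_lt hne
  have h1 := hmem x hx hux hxv
  have h2 := hmem c (hc.trans hx) huc hcv
  have h3 := h'.eq_of_le (le_inf h1.1 h2.1) (by omega)
  have h4 := h'.eq_of_le (le_inf h1.2 h2.2) (by omega)
  rw [← h3] at h4
  subst h4
  exact h.star_ne_top hmN (by omega) hv
    (f.injective.image_injective (hfu.trans hfv'))

/-- An isomorphism respecting stars induces an isomorphism of the Grassmann graphs one rank
lower, which is compatible with the order. -/
lemma exists_lower (h : IsGeometricRank r N) (h' : IsGeometricRank r' N')
    (haN : a + 3 ≤ N) (haN' : a' + 3 ≤ N')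
    {f : grassmannGraph r (a + 1) ≃g grassmannGraph r' (a' + 1)} (hf : MapsStarsToStars f) :
    ∃ f₁ : grassmannGraph r a ≃g grassmannGraph r' a',
      ∀ (u : RankLevel r a) (x : RankLevel r (a + 1)), (u : L) ≤ x ↔ (f₁ u : L') ≤ f x := by
  have hs := hf.symm h h' (by omega) (by omega) (by omega)
  choose φ hφ hφf using fun u : RankLevel r a => hf u (by rw [u.2])
  choose ψ hψ hψf using fun u : RankLevel r' a' => hs u (by rw [u.2])
  have hinc : ∀ (u : RankLevel r a) (x : RankLevel r (a + 1)), (u : L) ≤ x ↔ φ u ≤ f x := by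
    intro u x
    change _ ↔ f x ∈ grassmannStar r' (a' + 1) (φ u)
    rw [← hφf, f.injective.mem_set_image]
    rfl
  let e : RankLevel r a ≃ RankLevel r' a' :=
    { toFun := fun u => ⟨φ u, by have := hφ u; omega⟩
      invFun := fun u => ⟨ψ u, by have := hψ u; omega⟩
      left_inv := fun u => Subtype.ext (h.star_injective (m := a + 1) (by omega) (hψ _)
        (by rw [u.2]) (by rw [← hψf]; simp only; rw [← hφf, Set.image_image]; simp))
      right_inv := fun u => Subtype.ext (h'.star_injective (m := a' + 1) (by omega) (hφ _)
        (by rw [u.2]) (by rw [← hφf]; simp only; rw [← hψf, Set.image_image]; simp)) }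
  refine ⟨⟨e, fun {u w} => ?_⟩, hinc⟩
  rw [h.adj_iff_exists_ge, h'.adj_iff_exists_ge]
  refine and_congr e.injective.ne_iff ⟨fun ⟨z, h1, h2⟩ => ⟨f.symm z, ?_, ?_⟩,
    fun ⟨z, h1, h2⟩ => ⟨f z, (hinc _ _).1 h1, (hinc _ _).1 h2⟩⟩
  · rw [hinc, f.apply_symm_apply]
    exact h1
  · rw [hinc, f.apply_symm_apply]
    exact h2

/-- An isomorphism induced by one of the next higher rank respects tops, hence also stars. -/
lemma of_lower (h : IsGeometricRank r N) (h' : IsGeometricRank r' N')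
    (ha' : 1 ≤ a') (haN : a + 2 ≤ N) (haN' : a' + 1 ≤ N')
    {f : grassmannGraph r (a + 1) ≃g grassmannGraph r' (a' + 1)}
    {f₁ : grassmannGraph r a ≃g grassmannGraph r' a'}
    (hf : ∀ (u : RankLevel r a) (x : RankLevel r (a + 1)), (u : L) ≤ x ↔ (f₁ u : L') ≤ f x) :
    MapsStarsToStars f₁ := by
  intro u hu
  refine (h'.star_or_top_of_maximal ha' haN'
    (f₁.maximal_isClique_image (h.maximal_star haN hu))).resolve_right ?_
  rintro ⟨v', hv', hfv⟩
  refine h.star_ne_top haN hu (f.symm ⟨v', hv'⟩).2 (f₁.injective.image_injective ?_)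
  rw [hfv]
  ext y
  obtain ⟨y, rfl⟩ := f₁.surjective y
  rw [f₁.injective.mem_set_image]
  change (f₁ y : L') ≤ v' ↔ (y : L) ≤ f.symm ⟨v', hv'⟩
  rw [hf, f.apply_symm_apply]

/-- Descending along the ranks, an isomorphism of Grassmann graphs respecting stars is induced by
bijections of the points and of the lines; in particular both ranks agree. -/
theorem exists_points_lines (h : IsGeometricRank r N) (h' : IsGeometricRank r' N')
    (ha : 1 ≤ a) (ha' : 1 ≤ a') (haN : a + 3 ≤ N) (haN' : a' + 3 ≤ N')
    {f : grassmannGraph r (a + 1) ≃g grassmannGraph r' (a' + 1)} (hf : MapsStarsToStars f) :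
    a = a' ∧ ∃ (g₁ : RankLevel r 1 ≃ RankLevel r' 1)
      (g₂ : RankLevel r 2 ≃ RankLevel r' 2),
      (∀ (p : RankLevel r 1) (l : RankLevel r 2), (p : L) ≤ l ↔ (g₁ p : L') ≤ g₂ l) ∧
      ∀ (p : RankLevel r 1) (x : RankLevel r (a + 1)), (p : L) ≤ x ↔ (g₁ p : L') ≤ f x := by
  induction a generalizing a' with
  | zero => omega
  | succ b ih =>
    obtain ⟨b', rfl⟩ : ∃ b', a' = b' + 1 := ⟨a' - 1, by omega⟩
    obtain ⟨f₁, hf₁⟩ := hf.exists_lower h h' haN haN'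
    -- In rank one all elements are adjacent, in the ranks from `2` to `N - 2` they are not.
    rcases Nat.eq_zero_or_pos b with rfl | hb
    · rcases Nat.eq_zero_or_pos b' with rfl | hb'
      · exact ⟨rfl, f₁.toEquiv, f.toEquiv, hf₁, hf₁⟩
      · obtain ⟨x, y, hne, hadj⟩ := h'.exists_not_adj (m := b' + 1) (by omega) (by omega)
        refine absurd (f₁.symm.map_adj_iff.1 (h.adj_of_rank_one ?_)) hadj
        exact fun he => hne (f₁.symm.injective he)
    · rcases Nat.eq_zero_or_pos b' with rfl | hb'
      · obtain ⟨x, y, hne, hadj⟩ := h.exists_not_adj (m := b + 1) (by omega) (by omega)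
        refine absurd (f₁.map_adj_iff.1 (h'.adj_of_rank_one ?_)) hadj
        exact fun he => hne (f₁.injective he)
      · obtain ⟨hbb, g₁, g₂, hg, hgx⟩ := ih hb hb' (by omega) (by omega)
          (of_lower h h' (by omega) (by omega) (by omega) hf₁)
        refine ⟨by omega, g₁, g₂, hg, fun p x => ⟨fun hpx => ?_, fun hpx => ?_⟩⟩
        · obtain ⟨u, hpu, hux, hu⟩ := h.exists_between p x (b + 1) hpx (by rw [p.2]; omega)
            (by rw [x.2]; omega)
          exact ((hgx p ⟨u, hu⟩).1 hpu).trans ((hf₁ _ _).1 hux)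
        · obtain ⟨u, hpu, hux, hu⟩ := h'.exists_between (g₁ p) (f x) (b' + 1) hpx
            (by rw [(g₁ p).2]; omega) (by rw [(f x).2]; omega)
          obtain ⟨w, hw⟩ := f₁.surjective ⟨u, hu⟩
          have h1 : (f₁ w : L') = u := congrArg Subtype.val hw
          exact ((hgx p w).2 (h1 ▸ hpu)).trans ((hf₁ _ _).2 (h1 ▸ hux))

end MapsStarsToStars

/-- The Grassmann graph of rank `m` is that of the complementary rank in the order dual. -/
def grassmannGraphDual (h : IsGeometricRank r N) (hm : m + m' = N) : grassmannGraph r m ≃g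
    grassmannGraph (fun x : Lᵒᵈ => N - r (OrderDual.ofDual x)) m' where
  toEquiv := (OrderDual.toDual (α := L)).subtypeEquiv fun x => by
    have := h.le_rank_top x
    simp only [OrderDual.ofDual_toDual]
    omega
  map_rel_iff' {x y} := by
    rw [h.dual.adj_iff_rank_inf]
    have := h.le_rank_top (x ⊔ y : L)
    have h1 := h.mono (le_sup_left : (x : L) ≤ (x ⊔ y : L))
    have h2 := x.2
    change N - r (x ⊔ y : L) + 1 = m' ↔ r (x ⊔ y : L) = m + 1
    omega

/-- **Chow's theorem**: an isomorphism of Grassmann graphs of the same rank is induced by a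
collineation onto the other geometry or, in the middle rank only, onto its dual. -/
theorem chow (h : IsGeometricRank r N) (h' : IsGeometricRank r' N) (hm : 2 ≤ m) (hmN : m + 2 ≤ N)
    (f : grassmannGraph r m ≃g grassmannGraph r' m) :
    (∃ (g₁ : RankLevel r 1 ≃ RankLevel r' 1)
      (g₂ : RankLevel r 2 ≃ RankLevel r' 2),
      (∀ (p : RankLevel r 1) (l : RankLevel r 2), (p : L) ≤ l ↔ (g₁ p : L') ≤ g₂ l) ∧
        ∀ (p : RankLevel r 1) (x : RankLevel r m), (p : L) ≤ x ↔ (g₁ p : L') ≤ f x) ∨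
    (N = 2 * m ∧ ∃ (g₁ : RankLevel r 1 ≃ {x : L' // r' x + 1 = N})
      (g₂ : RankLevel r 2 ≃ {x : L' // r' x + 2 = N}),
      (∀ (p : RankLevel r 1) (l : RankLevel r 2), (p : L) ≤ l ↔ (g₂ l : L') ≤ g₁ p) ∧
        ∀ (p : RankLevel r 1) (x : RankLevel r m), (p : L) ≤ x ↔ (f x : L') ≤ g₁ p) := by
  obtain ⟨a, rfl⟩ : ∃ a, m = a + 1 := ⟨m - 1, by omega⟩
  rcases mapsStarsToStars_or_tops h h' (by omega) (by omega) (by omega) f with hst | htop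
  · exact Or.inl (hst.exists_points_lines h h' (by omega) (by omega) (by omega) (by omega)).2
  · right
    obtain ⟨b, hb⟩ : ∃ b, N = (a + 1) + (b + 1) := ⟨N - (a + 2), by omega⟩
    set δ := grassmannGraphDual h' hb.symm with hδ
    have hst : MapsStarsToStars (f.trans δ) := by
      intro u hu
      obtain ⟨v, hv, hfv⟩ := htop u hu
      refine ⟨OrderDual.toDual v, by simp only [OrderDual.ofDual_toDual]; omega, ?_⟩
      have hcomp : ⇑(f.trans δ) = δ ∘ f := rfl
      rw [hcomp, Set.image_comp, hfv]
      ext y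
      obtain ⟨y, rfl⟩ := δ.surjective y
      rw [δ.injective.mem_set_image]
      rfl
    obtain ⟨hab, g₁, g₂, hg, hgx⟩ :=
      hst.exists_points_lines h h'.dual (by omega) (by omega) (by omega) (by omega)
    refine ⟨by omega,
      g₁.trans (OrderDual.ofDual.subtypeEquiv fun x => ?_),
      g₂.trans (OrderDual.ofDual.subtypeEquiv fun x => ?_), hg, hgx⟩
    · change _ - _ = 1 ↔ _
      have := h'.le_rank_top (OrderDual.ofDual x)
      omega
    · change _ - _ = 2 ↔ _
      have := h'.le_rank_top (OrderDual.ofDual x)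
      omega

end GrassmannIso

/-! ### The span in a projective space -/

namespace PointLineSpace

variable {P : Type*} {G : PointLineSpace P}

lemma subset_span (X : Set P) : X ⊆ G.span X := Set.subset_sInter fun _ hS => hS.2

lemma span_subset {X S : Set P} (hS : G.IsSubspace S) (h : X ⊆ S) : G.span X ⊆ S :=
  Set.sInter_subset_of_mem ⟨hS, h⟩

lemma isSubspace_span (X : Set P) : G.IsSubspace (G.span X) :=
  fun p hp q hq hpq L hL hpL hqL _ hx S hS =>
    hS.1 p (hp S hS) q (hq S hS) hpq L hL hpL hqL hx

lemma IsSubspace.span_eq {S : Set P} (hS : G.IsSubspace S) : G.span S = S :=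
  (span_subset hS subset_rfl).antisymm (subset_span S)

lemma span_mono {X Y : Set P} (h : X ⊆ Y) : G.span X ⊆ G.span Y :=
  span_subset (isSubspace_span Y) (h.trans (subset_span Y))

lemma IsSubspace.inter {S T : Set P} (hS : G.IsSubspace S) (hT : G.IsSubspace T) :
    G.IsSubspace (S ∩ T) := fun p hp q hq hpq L hL hpL hqL =>
  Set.subset_inter (hS p hp.1 q hq.1 hpq L hL hpL hqL) (hT p hp.2 q hq.2 hpq L hL hpL hqL)

lemma isSubspace_univ : G.IsSubspace Set.univ := fun _ _ _ _ _ _ _ _ _ => Set.subset_univ _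

lemma isSubspace_empty : G.IsSubspace ∅ := fun _ hp => hp.elim

lemma isSubspace_singleton (p : P) : G.IsSubspace {p} :=
  fun _ ha _ hb hab => (hab (ha.trans hb.symm)).elim

lemma span_pair_subset {S : Set P} (hS : G.IsSubspace S) {x y : P} (hx : x ∈ S) (hy : y ∈ S) :
    G.span {x, y} ⊆ S :=
  span_subset hS (Set.insert_subset hx (Set.singleton_subset_iff.2 hy))

lemma left_mem_span_pair (x y : P) : x ∈ G.span {x, y} := subset_span _ (Or.inl rfl)

lemma right_mem_span_pair (x y : P) : y ∈ G.span {x, y} := subset_span _ (Or.inr rfl)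

namespace IsLinearSpace

lemma isSubspace_line (hG : G.IsLinearSpace) {L : Set P} (hL : L ∈ G.lines) : G.IsSubspace L :=
  fun p hp q hq hpq _ hM hpM hqM =>
    ((hG.existsUnique_line p q hpq).unique ⟨hM, hpM, hqM⟩ ⟨hL, hp, hq⟩).subset

lemma span_pair_eq_line (hG : G.IsLinearSpace) {L : Set P} (hL : L ∈ G.lines) {p q : P}
    (hpq : p ≠ q) (hp : p ∈ L) (hq : q ∈ L) : G.span {p, q} = L :=
  (span_pair_subset (hG.isSubspace_line hL) hp hq).antisymm
    (isSubspace_span _ p (left_mem_span_pair p q) q (right_mem_span_pair p q) hpq L hL hp hq)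

lemma span_pair_mem_lines (hG : G.IsLinearSpace) {p q : P} (hpq : p ≠ q) :
    G.span {p, q} ∈ G.lines := by
  obtain ⟨L, ⟨hL, hp, hq⟩, -⟩ := hG.existsUnique_line p q hpq
  rwa [hG.span_pair_eq_line hL hpq hp hq]

lemma mem_span_pair_exchange (hG : G.IsLinearSpace) {x y z : P} (hz : z ∈ G.span {x, y})
    (hzx : z ≠ x) : y ∈ G.span {x, z} := by
  by_cases hxy : x = y
  · exact hxy ▸ left_mem_span_pair _ _
  · rw [hG.span_pair_eq_line (hG.span_pair_mem_lines hxy) hzx.symm (left_mem_span_pair x y) hz]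
    exact right_mem_span_pair x y

/-- Three points not on a line span a plane. -/
lemma hasDim_two (hG : G.IsLinearSpace) {a b c : P} (hbc : b ≠ c) (ha : a ∉ G.span {b, c}) :
    G.HasDim (G.span {a, b, c}) 2 := by
  classical
  have hbS : b ∈ G.span {a, b, c} := subset_span _ (by simp)
  have hcS : c ∈ G.span {a, b, c} := subset_span _ (by simp)
  have haS : a ∈ G.span {a, b, c} := subset_span _ (by simp)
  refine ⟨isSubspace_span _, ⟨{a, b, c}, ?_, by simp⟩, ?_⟩
  · refine Finset.card_eq_three.2 ⟨a, b, c, ?_, ?_, hbc, rfl⟩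
    · rintro rfl
      exact ha (left_mem_span_pair _ _)
    · rintro rfl
      exact ha (right_mem_span_pair _ _)
  · rintro m ⟨X, rfl, hX⟩
    by_contra! hlt
    have hcases : X.card = 0 ∨ X.card = 1 ∨ X.card = 2 := by omega
    rw [← hX] at hbS hcS haS
    rcases hcases with h | h | h
    · rw [Finset.card_eq_zero.1 h, Finset.coe_empty, isSubspace_empty.span_eq] at hbS
      exact hbS
    · obtain ⟨p, rfl⟩ := Finset.card_eq_one.1 h
      rw [Finset.coe_singleton, (isSubspace_singleton p).span_eq] at hbS hcS
      exact hbc (hbS.trans hcS.symm)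
    · obtain ⟨p, q, hpq, rfl⟩ := Finset.card_eq_two.1 h
      rw [Finset.coe_pair] at hbS hcS haS
      rw [hG.span_pair_eq_line (hG.span_pair_mem_lines hpq) hbc hbS hcS] at ha
      exact ha haS

end IsLinearSpace

lemma exists_finite_mem_span {X : Set P} {x : P} (hx : x ∈ G.span X) :
    ∃ F ⊆ X, F.Finite ∧ x ∈ G.span F := by
  let J : Set P := {x | ∃ F ⊆ X, F.Finite ∧ x ∈ G.span F}
  suffices hJ : G.IsSubspace J from
    span_subset hJ (fun y hy => ⟨{y}, Set.singleton_subset_iff.2 hy, Set.finite_singleton y,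
      subset_span _ rfl⟩) hx
  rintro p ⟨F, hFX, hF, hp⟩ q ⟨F', hFX', hF', hq⟩ hpq L hL hpL hqL z hz
  exact ⟨F ∪ F', Set.union_subset hFX hFX', hF.union hF',
    isSubspace_span _ p (span_mono Set.subset_union_left hp) q
      (span_mono Set.subset_union_right hq) hpq L hL hpL hqL hz⟩

namespace IsProjective

/-- Joining points is associative: a form of the Veblen–Young axiom that holds without any
assumption on the points being distinct or in general position. -/
lemma exists_mem_span_pair_assoc (hG : G.IsProjective) {a b x y z : P} (hz : z ∈ G.span {x, y})
    (hx : x ∈ G.span {a, b}) : ∃ w ∈ G.span {b, y}, z ∈ G.span {a, w} := by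
  by_cases hza : z = a
  · exact ⟨b, left_mem_span_pair _ _, hza ▸ left_mem_span_pair _ _⟩
  by_cases hby : b = y
  · subst hby
    exact ⟨b, left_mem_span_pair _ _,
      span_pair_subset (isSubspace_span _) hx (right_mem_span_pair _ _) hz⟩
  by_cases ha : a ∈ G.span {b, y}
  · refine ⟨z, span_pair_subset (isSubspace_span _) ?_ (right_mem_span_pair _ _) hz,
      right_mem_span_pair _ _⟩
    exact span_pair_subset (isSubspace_span _) ha (left_mem_span_pair _ _) hx
  have haS : a ∈ G.span {a, b, y} := subset_span _ (by simp)
  have hbS : b ∈ G.span {a, b, y} := subset_span _ (by simp)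
  have hyS : y ∈ G.span {a, b, y} := subset_span _ (by simp)
  have hxS := span_pair_subset (isSubspace_span _) haS hbS hx
  have hzS := span_pair_subset (isSubspace_span _) hxS hyS hz
  obtain ⟨w, hw1, hw2⟩ := (hG.2 _ (hG.1.hasDim_two hby ha)).1 _ (hG.1.span_pair_mem_lines hby) _
    (hG.1.span_pair_mem_lines hza) (span_pair_subset (isSubspace_span _) hbS hyS)
    (span_pair_subset (isSubspace_span _) hzS haS)
  rw [Set.pair_comm] at hw2
  refine ⟨w, hw1, hG.1.mem_span_pair_exchange hw2 ?_⟩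
  rintro rfl
  exact ha hw1

/-- The join of two nonempty subspaces is the union of the lines joining their points. -/
lemma mem_span_union (hG : G.IsProjective) {S T : Set P} (hS : G.IsSubspace S)
    (hT : G.IsSubspace T) (hSne : S.Nonempty) (hTne : T.Nonempty) {z : P}
    (hz : z ∈ G.span (S ∪ T)) : ∃ s ∈ S, ∃ t ∈ T, z ∈ G.span {s, t} := by
  let J : Set P := {z | ∃ s ∈ S, ∃ t ∈ T, z ∈ G.span {s, t}}
  suffices hJ : G.IsSubspace J by
    obtain ⟨s₀, hs₀⟩ := hSne
    obtain ⟨t₀, ht₀⟩ := hTne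
    exact span_subset hJ (Set.union_subset
      (fun s hs => ⟨s, hs, t₀, ht₀, left_mem_span_pair _ _⟩)
      (fun t ht => ⟨s₀, hs₀, t, ht, right_mem_span_pair _ _⟩)) hz
  rintro x ⟨s₁, hs₁, t₁, ht₁, hx⟩ y ⟨s₂, hs₂, t₂, ht₂, hy⟩ hxy L hL hxL hyL z hzL
  rw [← hG.1.span_pair_eq_line hL hxy hxL hyL] at hzL
  -- Reassociate `(s₁ t₁) (s₂ t₂)` as `(s₁ s₂) (t₁ t₂)`.
  obtain ⟨w, hw, hzw⟩ := hG.exists_mem_span_pair_assoc hzL hx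
  rw [Set.pair_comm] at hw
  obtain ⟨v, hv, hwv⟩ := hG.exists_mem_span_pair_assoc hw hy
  rw [Set.pair_comm] at hwv hzw
  obtain ⟨u, hu, hzu⟩ := hG.exists_mem_span_pair_assoc hzw hwv
  rw [Set.pair_comm] at hzu
  exact ⟨u, span_pair_subset hS hs₂ hs₁ hu, v, span_pair_subset hT ht₂ ht₁ hv, hzu⟩

lemma mem_span_insert_exchange (hG : G.IsProjective) {X : Set P} {x y : P}
    (hy : y ∈ G.span (insert x X)) (hyX : y ∉ G.span X) : x ∈ G.span (insert y X) := by
  rcases X.eq_empty_or_nonempty with rfl | hX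
  · rw [insert_empty_eq, (isSubspace_singleton x).span_eq] at hy
    rw [Set.mem_singleton_iff.1 hy]
    exact subset_span _ (Or.inl rfl)
  · have hsub : insert x X ⊆ {x} ∪ G.span X :=
      Set.insert_subset (Or.inl rfl) ((subset_span X).trans Set.subset_union_right)
    obtain ⟨s, rfl, t, ht, hyt⟩ := hG.mem_span_union (isSubspace_singleton x)
      (isSubspace_span X) (Set.singleton_nonempty x) (hX.mono (subset_span X)) (span_mono hsub hy)
    rw [Set.pair_comm] at hyt
    refine span_pair_subset (isSubspace_span _) (span_mono (Set.subset_insert _ _) ht)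
      (subset_span _ (Or.inl rfl)) (hG.1.mem_span_pair_exchange hyt ?_)
    rintro rfl
    exact hyX ht

end IsProjective

/-! ### The matroid of a projective space -/

/-- No point of `I` lies in the span of the others. -/
def SpanIndep (G : PointLineSpace P) (I : Set P) : Prop := ∀ x ∈ I, x ∉ G.span (I \ {x})

lemma SpanIndep.insert (hG : G.IsProjective) {I : Set P} (hI : G.SpanIndep I) {x : P}
    (hx : x ∉ G.span I) : G.SpanIndep (insert x I) := by
  have hxI : x ∉ I := fun h => hx (subset_span I h)
  rintro y (rfl | hy)
  · rwa [Set.insert_sdiff_self_of_notMem hxI]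
  · have hyx : y ≠ x := by rintro rfl; exact hxI hy
    rw [Set.insert_sdiff_of_notMem _ (by simpa using hyx.symm)]
    intro hmem
    have := hG.mem_span_insert_exchange hmem (hI y hy)
    rw [Set.insert_sdiff_singleton, Set.insert_eq_of_mem hy] at this
    exact hx this

/-- The matroid on the points of a projective space whose closure operator is the span. -/
def spanMatroid (hG : G.IsProjective) : Matroid P :=
  (IndepMatroid.ofFinitary Set.univ G.SpanIndep (fun _ h => h.elim)
    (fun _ _ hJ hIJ x hx hmem => hJ x (hIJ hx) (span_mono (Set.sdiff_subset_sdiff_left hIJ) hmem))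
    (by
      intro I B hI hImax hB
      by_contra! hall
      have hBI : B ⊆ G.span I := by
        intro x hx
        by_cases hxI : x ∈ I
        · exact subset_span I hxI
        · by_contra hxs
          exact hall x ⟨hx, hxI⟩ (hI.insert hG hxs)
      have hBs : ∀ x, x ∈ G.span B := by
        intro x
        by_contra hx
        exact hx (subset_span B (hB.2 (hB.1.insert hG hx) (Set.subset_insert _ _) (Or.inl rfl)))
      refine hImax ⟨hI, fun J hJ hIJ x hx => ?_⟩
      by_contra hxI
      have hsub : I ⊆ J \ {x} := fun y hy => ⟨hIJ hy, fun hyx => hxI (hyx ▸ hy)⟩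
      exact hJ x hx (span_mono hsub (span_subset (isSubspace_span I) hBI (hBs x))))
    (by
      intro I hI x hx hmem
      obtain ⟨F, hFI, hF, hxF⟩ := exists_finite_mem_span hmem
      have hsub : F ⊆ insert x F \ {x} := fun y hy => ⟨Or.inr hy, (hFI hy).2⟩
      exact hI (insert x F) (Set.insert_subset hx (hFI.trans Set.sdiff_subset)) (hF.insert x) x
        (Or.inl rfl) (span_mono hsub hxF))
    (fun _ _ => Set.subset_univ _)).matroid

section Matroid

variable (hG : G.IsProjective)

@[simp] lemma spanMatroid_ground : (spanMatroid hG).E = Set.univ := rfl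

lemma spanMatroid_closure (X : Set P) : (spanMatroid hG).closure X = G.span X := by
  obtain ⟨I, hI⟩ := (spanMatroid hG).exists_isBasis X (Set.subset_univ X)
  have hins : ∀ x, x ∉ I → (x ∈ G.span I ↔ ¬ (spanMatroid hG).Indep (insert x I)) := by
    intro x hx
    refine ⟨fun hxs hind => hind x (Or.inl rfl) ?_, fun hind => ?_⟩
    · rwa [Set.insert_sdiff_self_of_notMem hx]
    · by_contra hxs
      exact hind (SpanIndep.insert hG hI.indep hxs)
  have hcl : (spanMatroid hG).closure I = G.span I := by
    ext x
    by_cases hx : x ∈ I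
    · exact iff_of_true ((spanMatroid hG).mem_closure_of_mem hx (Set.subset_univ I))
        (subset_span I hx)
    · rw [hins x hx, ← not_iff_not, not_not,
        hI.indep.notMem_closure_iff_of_notMem hx (Set.mem_univ x)]
  rw [← hI.closure_eq_closure, hcl]
  refine (span_mono hI.subset).antisymm (span_subset (isSubspace_span I) ?_)
  rw [← hcl]
  exact hI.subset_closure

lemma isIndependent_iff {X : Set P} : G.IsIndependent X ↔ (spanMatroid hG).Indep X := by
  rw [Matroid.indep_iff_forall_closure_ssubset_of_ssubset (Set.subset_univ X)]
  simp only [spanMatroid_closure]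
  exact forall₂_congr fun Y hY =>
    ⟨fun hne => (span_mono hY.subset).ssubset_of_ne hne, fun h => h.ne⟩

lemma isBase_iff {B : Set P} : G.IsBase B ↔ (spanMatroid hG).IsBase B := by
  rw [Matroid.isBase_iff_indep_closure_eq, spanMatroid_closure, IsBase, isIndependent_iff hG]
  rfl

variable {hG}

/-- Independent sets spanning disjoint subspaces have independent union. This is where
projectivity, beyond the exchange property, enters. -/
lemma indep_union_of_disjoint_span {A K : Set P} (hA : (spanMatroid hG).Indep A)
    (hK : (spanMatroid hG).Indep K) (hd : Disjoint (G.span A) (G.span K)) :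
    (spanMatroid hG).Indep (A ∪ K) := by
  rw [hA.union_indep_iff_forall_notMem_closure_right hK]
  rintro e ⟨heK, heA⟩ hmem
  rw [spanMatroid_closure] at hmem
  have hmem : e ∈ G.span (G.span A ∪ G.span (K \ {e})) :=
    span_mono (Set.union_subset_union (subset_span _) (subset_span _)) hmem
  have hsub : G.span (K \ {e}) ⊆ G.span K := span_mono Set.sdiff_subset
  have heA' : e ∉ G.span A := fun h => hd.le_bot ⟨h, subset_span K heK⟩
  have heK' : e ∉ G.span (K \ {e}) := hK e heK
  rcases (G.span A).eq_empty_or_nonempty with h0 | hAne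
  · rw [h0, Set.empty_union, (isSubspace_span _).span_eq] at hmem
    exact heK' hmem
  rcases (G.span (K \ {e})).eq_empty_or_nonempty with h0 | hKne
  · rw [h0, Set.union_empty, (isSubspace_span _).span_eq] at hmem
    exact heA' hmem
  obtain ⟨s, hs, t, ht, hst⟩ := hG.mem_span_union (isSubspace_span _) (isSubspace_span _)
    hAne hKne hmem
  rw [Set.pair_comm] at hst
  have hs' := hG.1.mem_span_pair_exchange hst (by rintro rfl; exact heK' ht)
  exact hd.le_bot ⟨hs, span_pair_subset (isSubspace_span K) (hsub ht) (subset_span K heK) hs'⟩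

/-- Bases of `S` and `T` extending a common base of `S ∩ T` have independent union. -/
lemma indep_union_of_isBasis {S T I J K : Set P} (hS : G.IsSubspace S) (hT : G.IsSubspace T)
    (hI : (spanMatroid hG).IsBasis I (S ∩ T)) (hJ : (spanMatroid hG).IsBasis J S)
    (hK : (spanMatroid hG).IsBasis K T) (hIJ : I ⊆ J) (hIK : I ⊆ K) :
    (spanMatroid hG).Indep (J ∪ K) := by
  have hJK : J ∪ K = (J \ I) ∪ K := by
    rw [← Set.sdiff_union_of_subset hIJ, Set.union_assoc, Set.union_eq_self_of_subset_left hIK]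
    simp
  rw [hJK]
  refine indep_union_of_disjoint_span (hJ.indep.subset Set.sdiff_subset) hK.indep ?_
  rw [Set.disjoint_left]
  intro x hx hxK
  have hxS : x ∈ S := span_subset hS (Set.sdiff_subset.trans hJ.subset) hx
  have hxT : x ∈ T := span_subset hT hK.subset hxK
  have hxI : x ∈ (spanMatroid hG).closure I := hI.subset_closure ⟨hxS, hxT⟩
  have hx' : x ∈ (spanMatroid hG).closure (J \ I) := by rwa [spanMatroid_closure]
  have hind : (spanMatroid hG).Indep ((J \ I) ∪ I) := by
    rw [Set.sdiff_union_of_subset hIJ]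
    exact hJ.indep
  have : x ∈ (spanMatroid hG).closure ((J \ I) ∩ I) := by
    rw [hind.closure_inter_eq_inter_closure]
    exact ⟨hx', hxI⟩
  rw [Set.sdiff_inter_self, spanMatroid_closure, isSubspace_empty.span_eq] at this
  exact this

end Matroid

end PointLineSpace

/-! ### The lattice of subspaces and its rank function -/

namespace PointLineSpace

variable {P : Type*} {G : PointLineSpace P}

/-- The subspaces of a point-line space. They form a lattice in which the join of two subspaces is
the span of their union. -/
abbrev Subspace (G : PointLineSpace P) := {S : Set P // G.IsSubspace S}

instance : Lattice G.Subspace where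
  sup S T := ⟨G.span (S ∪ T), isSubspace_span _⟩
  inf S T := ⟨S ∩ T, S.2.inter T.2⟩
  le_sup_left _ _ := Set.subset_union_left.trans (subset_span _)
  le_sup_right _ _ := Set.subset_union_right.trans (subset_span _)
  sup_le _ _ U hS hT := span_subset U.2 (Set.union_subset hS hT)
  inf_le_left _ _ := Set.inter_subset_left
  inf_le_right _ _ := Set.inter_subset_right
  le_inf _ _ _ hS hT := Set.subset_inter hS hT

instance : BoundedOrder G.Subspace where
  top := ⟨Set.univ, isSubspace_univ⟩
  bot := ⟨∅, isSubspace_empty⟩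
  le_top _ := Set.subset_univ _
  bot_le _ := Set.empty_subset _

lemma Subspace.coe_inf (S T : G.Subspace) : ((S ⊓ T : G.Subspace) : Set P) = (S : Set P) ∩ T := rfl

lemma Subspace.coe_sup (S T : G.Subspace) :
    ((S ⊔ T : G.Subspace) : Set P) = G.span ((S : Set P) ∪ T) := rfl

/-- The rank of a set of points: the size of a maximal independent subset. For subspaces it
exceeds the dimension by one. -/
noncomputable def rank (hG : G.IsProjective) (X : Set P) : ℕ := ((spanMatroid hG).eRk X).toNat

section Rank

variable {hG : G.IsProjective}

lemma rank_eq_ncard {I X : Set P} (hI : (spanMatroid hG).IsBasis I X) : rank hG X = I.ncard := by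
  rw [rank, hI.eRk_eq_encard, Set.ncard]

lemma span_eq_of_isBasis {I S : Set P} (hI : (spanMatroid hG).IsBasis I S)
    (hS : G.IsSubspace S) : G.span I = S := by
  rw [← spanMatroid_closure hG, hI.closure_eq_closure, spanMatroid_closure, hS.span_eq]

lemma isBasis_span {I : Set P} (hI : (spanMatroid hG).Indep I) :
    (spanMatroid hG).IsBasis I (G.span I) := by
  rw [← spanMatroid_closure hG]
  exact hI.isBasis_closure

lemma rank_span {I : Set P} (hI : (spanMatroid hG).Indep I) : rank hG (G.span I) = I.ncard :=
  rank_eq_ncard (isBasis_span hI)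

lemma span_inter_span {X Y B : Set P} (hB : (spanMatroid hG).Indep B) (hX : X ⊆ B) (hY : Y ⊆ B) :
    G.span X ∩ G.span Y = G.span (X ∩ Y) := by
  simp only [← spanMatroid_closure hG]
  exact ((hB.subset (Set.union_subset hX hY)).closure_inter_eq_inter_closure).symm

lemma span_inter_eq {X B : Set P} (hB : (spanMatroid hG).Indep B) (hX : X ⊆ B) :
    G.span X ∩ B = X := by
  rw [← spanMatroid_closure hG]
  exact hB.closure_inter_eq_self_of_subset hX

lemma span_span_union_span (X Y : Set P) : G.span (G.span X ∪ G.span Y) = G.span (X ∪ Y) :=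
  (span_subset (isSubspace_span _) (Set.union_subset (span_mono Set.subset_union_left)
    (span_mono Set.subset_union_right))).antisymm
    (span_mono (Set.union_subset_union (subset_span X) (subset_span Y)))

variable [(spanMatroid hG).RankFinite]

lemma isGeometricRank (hG : G.IsProjective) [(spanMatroid hG).RankFinite] :
    IsGeometricRank (fun S : G.Subspace => rank hG S) (rank hG Set.univ) where
  strictMono S T hST := by
    obtain ⟨I, hI⟩ := (spanMatroid hG).exists_isBasis (S : Set P) (Set.subset_univ _)
    obtain ⟨J, hJ, hIJ⟩ := hI.indep.subset_isBasis_of_subset (hI.subset.trans hST.le)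
      (Set.subset_univ _)
    dsimp only
    rw [rank_eq_ncard hI, rank_eq_ncard hJ]
    refine Set.ncard_lt_ncard (hIJ.ssubset_of_ne ?_) hJ.indep.finite
    rintro rfl
    exact hST.ne (Subtype.ext ((span_eq_of_isBasis hI S.2).symm.trans (span_eq_of_isBasis hJ T.2)))
  sup_add_inf S T := by
    obtain ⟨I, hI⟩ := (spanMatroid hG).exists_isBasis ((S : Set P) ∩ T) (Set.subset_univ _)
    obtain ⟨J, hJ, hIJ⟩ := hI.indep.subset_isBasis_of_subset
      (hI.subset.trans Set.inter_subset_left) (Set.subset_univ _)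
    obtain ⟨K, hK, hIK⟩ := hI.indep.subset_isBasis_of_subset
      (hI.subset.trans Set.inter_subset_right) (Set.subset_univ _)
    have hJK := indep_union_of_isBasis S.2 T.2 hI hJ hK hIJ hIK
    have hinter : J ∩ K = I := by
      refine Set.Subset.antisymm (fun x hx => ?_) (Set.subset_inter hIJ hIK)
      rw [← span_inter_eq hJ.indep hIJ, span_eq_of_isBasis hI (S.2.inter T.2)]
      exact ⟨⟨hJ.subset hx.1, hK.subset hx.2⟩, hx.1⟩
    have hsup : ((S ⊔ T : G.Subspace) : Set P) = G.span (J ∪ K) := by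
      rw [Subspace.coe_sup, ← span_eq_of_isBasis hJ S.2, ← span_eq_of_isBasis hK T.2,
        span_span_union_span]
    rw [hsup, Subspace.coe_inf, rank_span hJK, rank_eq_ncard hI, rank_eq_ncard hJ,
      rank_eq_ncard hK, ← hinter, Set.ncard_union_add_ncard_inter _ _ hJ.indep.finite
      hK.indep.finite]
  rank_bot := by
    change rank hG ∅ = 0
    rw [← isSubspace_empty.span_eq, rank_span (Matroid.empty_indep _), Set.ncard_empty]
  rank_top := rfl
  exists_between S T j hST hS hT := by
    obtain ⟨I, hI⟩ := (spanMatroid hG).exists_isBasis (S : Set P) (Set.subset_univ _)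
    obtain ⟨J, hJ, hIJ⟩ := hI.indep.subset_isBasis_of_subset (hI.subset.trans hST)
      (Set.subset_univ _)
    rw [rank_eq_ncard hI] at hS
    rw [rank_eq_ncard hJ] at hT
    obtain ⟨K, hIK, hKJ, hK⟩ := Set.exists_subsuperset_card_eq hIJ hS hT
    refine ⟨⟨G.span K, isSubspace_span K⟩, ?_, ?_, ?_⟩
    · change (S : Set P) ⊆ G.span K
      rw [← span_eq_of_isBasis hI S.2]
      exact span_mono hIK
    · change G.span K ⊆ (T : Set P)
      rw [← span_eq_of_isBasis hJ T.2]
      exact span_mono hKJ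
    · rw [rank_span (hJ.indep.subset hKJ), hK]
  exists_relCompl U V W hUV hVW := by
    obtain ⟨I, hI⟩ := (spanMatroid hG).exists_isBasis (U : Set P) (Set.subset_univ _)
    obtain ⟨J, hJ, hIJ⟩ := hI.indep.subset_isBasis_of_subset (hI.subset.trans hUV)
      (Set.subset_univ _)
    obtain ⟨K, hK, hJK⟩ := hJ.indep.subset_isBasis_of_subset (hJ.subset.trans hVW)
      (Set.subset_univ _)
    refine ⟨⟨G.span (I ∪ (K \ J)), isSubspace_span _⟩, Subtype.ext ?_, Subtype.ext ?_⟩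
    · rw [Subspace.coe_inf, ← span_eq_of_isBasis hJ V.2,
        span_inter_span hK.indep hJK (Set.union_subset (hIJ.trans hJK) Set.sdiff_subset),
        Set.inter_union_distrib_left, Set.inter_sdiff_self, Set.union_empty,
        Set.inter_eq_self_of_subset_right hIJ, span_eq_of_isBasis hI U.2]
    · rw [Subspace.coe_sup, ← span_eq_of_isBasis hJ V.2, span_span_union_span, ← Set.union_assoc,
        Set.union_eq_self_of_subset_right hIJ, Set.union_sdiff_cancel hJK,
        span_eq_of_isBasis hK W.2]

lemma hasDim_iff {S : Set P} {d : ℕ} :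
    G.HasDim S d ↔ G.IsSubspace S ∧ rank hG S = d + 1 := by
  classical
  refine and_congr_right fun hS => ?_
  obtain ⟨I, hI⟩ := (spanMatroid hG).exists_isBasis S (Set.subset_univ _)
  have hle : IsLeast {m : ℕ | ∃ X : Finset P, X.card = m ∧ G.span (X : Set P) = S} (rank hG S) := by
    refine ⟨⟨hI.indep.finite.toFinset, ?_, ?_⟩, ?_⟩
    · rw [rank_eq_ncard hI, Set.ncard_eq_toFinset_card _ hI.indep.finite]
    · rw [Set.Finite.coe_toFinset, span_eq_of_isBasis hI hS]
    · rintro m ⟨X, rfl, hX⟩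
      obtain ⟨J, hJ⟩ := (spanMatroid hG).exists_isBasis (X : Set P) (Set.subset_univ _)
      have hJS : G.span J = S := by
        rw [← hX, ← spanMatroid_closure hG, hJ.closure_eq_closure, spanMatroid_closure]
      rw [← hJS, rank_span hJ.indep, ← Set.ncard_coe_finset]
      exact Set.ncard_le_ncard hJ.subset
  exact ⟨fun h => hle.unique h, fun h => h ▸ hle⟩

end Rank

lemma rankFinite_of_hasDim {n : ℕ} (hG : G.IsProjective) (hn : G.HasDim Set.univ n) :
    (spanMatroid hG).RankFinite := by
  obtain ⟨X, -, hX⟩ := hn.2.1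
  have hsp : (spanMatroid hG).Spanning (X : Set P) := by
    rw [Matroid.spanning_iff_closure_eq (Set.subset_univ _), spanMatroid_closure, hX]
    rfl
  obtain ⟨B, hB, hBX⟩ := hsp.exists_isBase_subset
  exact hB.rankFinite_of_finite (X.finite_toSet.subset hBX)

/-- Any two subspaces are spanned by parts of a common base. -/
lemma exists_common_base (hG : G.IsProjective) {S T : Set P} (hS : G.IsSubspace S)
    (hT : G.IsSubspace T) :
    ∃ B, (spanMatroid hG).IsBase B ∧ (∃ X ⊆ B, G.span X = S) ∧ ∃ Y ⊆ B, G.span Y = T := by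
  obtain ⟨I, hI⟩ := (spanMatroid hG).exists_isBasis (S ∩ T) (Set.subset_univ _)
  obtain ⟨J, hJ, hIJ⟩ := hI.indep.subset_isBasis_of_subset
    (hI.subset.trans Set.inter_subset_left) (Set.subset_univ _)
  obtain ⟨K, hK, hIK⟩ := hI.indep.subset_isBasis_of_subset
    (hI.subset.trans Set.inter_subset_right) (Set.subset_univ _)
  obtain ⟨B, hB, hJKB⟩ := (indep_union_of_isBasis hS hT hI hJ hK hIJ hIK).exists_isBase_superset
  exact ⟨B, hB, ⟨J, Set.subset_union_left.trans hJKB, span_eq_of_isBasis hJ hS⟩,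
    K, Set.subset_union_right.trans hJKB, span_eq_of_isBasis hK hT⟩

end PointLineSpace

/-! ### Base subsets -/

namespace PointLineSpace

variable {P : Type*} {G : PointLineSpace P} {k : ℕ}

/-- The `k`-dimensional subspaces spanned by subsets of `B`. -/
def baseSubset (G : PointLineSpace P) (k : ℕ) (B : Set P) : Set (G.grassmann k) :=
  {S | ∃ X : Set P, X ⊆ B ∧ G.span X = (S : Set P)}

/-- The `k`-dimensional subspaces spanned by subsets of `B` that contain `p` but not `q`. For
distinct `p` and `q` in a base `B`, these are the complements in the base subset of `B` of its
maximal inexact subsets, that is, of the maximal ones lying in a second base subset. -/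
def sepSubset (G : PointLineSpace P) (k : ℕ) (B : Set P) (p q : P) : Set (G.grassmann k) :=
  {S | S ∈ G.baseSubset k B ∧ p ∈ (S : Set P) ∧ q ∉ (S : Set P)}

section

variable {hG : G.IsProjective} {B : Set P}

lemma span_inter_of_mem_baseSubset (hB : (spanMatroid hG).IsBase B) {S : G.grassmann k}
    (hS : S ∈ G.baseSubset k B) : G.span (S ∩ B) = S := by
  obtain ⟨X, hX, hXS⟩ := hS
  rw [← hXS, span_inter_eq hB.indep hX]

/-- If the members of `R` separate the points of the base `B`, then every point of `B` is an
intersection of members of `R`, so `B` lies in every base whose base subset contains `R`. -/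
lemma subset_of_separating {B₁ : Set P} (hB : (spanMatroid hG).IsBase B)
    (hB₁ : (spanMatroid hG).IsBase B₁) (hcard : 1 < B.ncard) {R : Set (G.grassmann k)}
    (hR : R ⊆ G.baseSubset k B) (hR₁ : R ⊆ G.baseSubset k B₁)
    (hsep : ∀ p ∈ B, ∀ q ∈ B, p ≠ q → ∃ S ∈ R, p ∈ (S : Set P) ∧ q ∉ (S : Set P)) : B ⊆ B₁ := by
  intro p hp
  let ι := {S : G.grassmann k // S ∈ R ∧ p ∈ (S : Set P)}
  obtain ⟨q, hq, hqp⟩ := Set.exists_ne_of_one_lt_ncard hcard p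
  obtain ⟨S₀, hS₀, hpS₀, -⟩ := hsep p hp q hq hqp.symm
  have : Nonempty ι := ⟨⟨S₀, hS₀, hpS₀⟩⟩
  have key : ∀ {C : Set P}, (spanMatroid hG).IsBase C → R ⊆ G.baseSubset k C →
      G.span (⋂ S : ι, (S.1 : Set P) ∩ C) = ⋂ S : ι, (S.1 : Set P) := by
    intro C hC hRC
    rw [← spanMatroid_closure hG, hC.indep.closure_iInter_eq_biInter_closure_of_forall_subset
      (fun S => Set.inter_subset_right)]
    refine Set.iInter_congr fun S => ?_
    rw [spanMatroid_closure, span_inter_of_mem_baseSubset hC (hRC S.2.1)]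
  have hpB : (⋂ S : ι, (S.1 : Set P) ∩ B) = {p} := by
    refine Set.Subset.antisymm (fun x hx => ?_)
      (Set.singleton_subset_iff.2 (Set.mem_iInter.2 fun S => ⟨S.2.2, hp⟩))
    rw [Set.mem_iInter] at hx
    by_contra hxp
    obtain ⟨S, hS, hpS, hxS⟩ := hsep p hp x (hx ⟨S₀, hS₀, hpS₀⟩).2 (Ne.symm hxp)
    exact hxS (hx ⟨S, hS, hpS⟩).1
  have h₁ := key hB₁ hR₁
  rw [← key hB hR, hpB, (isSubspace_singleton p).span_eq] at h₁
  have hne : (⋂ S : ι, (S.1 : Set P) ∩ B₁).Nonempty := by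
    rw [Set.nonempty_iff_ne_empty]
    intro h0
    rw [h0, isSubspace_empty.span_eq] at h₁
    exact (Set.singleton_nonempty p).ne_empty h₁.symm
  obtain ⟨x, hx⟩ := hne
  have hxp : x = p := by
    have := subset_span (G := G) _ hx
    rwa [h₁] at this
  exact hxp ▸ (Set.mem_iInter.1 hx ⟨S₀, hS₀, hpS₀⟩).2

/-- Replacing the point `p` of a base by a third point of the line through `p` and `q` gives a
second base, whose base subset contains all members not separating `p` from `q`. -/
lemma exists_base_of_not_separating (hB : (spanMatroid hG).IsBase B) (hcard : 2 < B.ncard)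
    {p q : P} (hp : p ∈ B) (hq : q ∈ B) (hpq : p ≠ q) :
    ∃ B₁, (spanMatroid hG).IsBase B₁ ∧ p ∉ B₁ ∧
      G.baseSubset k B \ G.sepSubset k B p q ⊆ G.baseSubset k B₁ := by
  obtain ⟨c, hcB, hc⟩ : ∃ c ∈ B, c ∉ ({p, q} : Set P) := by
    refine Set.exists_mem_notMem_of_ncard_lt_ncard ?_ (Set.toFinite _)
    rwa [Set.ncard_pair hpq]
  have hpqB : {p, q} ⊆ B := Set.insert_subset hp (Set.singleton_subset_iff.2 hq)
  have hcspan : c ∉ G.span {p, q} := by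
    intro h
    have := span_inter_eq hB.indep hpqB
    exact hc (this ▸ ⟨h, hcB⟩)
  obtain ⟨z, hz, hzpq⟩ : ∃ z ∈ G.span {p, q}, z ∉ ({p, q} : Set P) := by
    by_contra! hall
    have h3 := (hG.2 _ (hG.1.hasDim_two hpq hcspan)).2 _
      (hG.1.span_pair_mem_lines hpq) (span_mono (Set.subset_insert _ _))
    have h2 := h3.trans (Set.encard_le_encard (show G.span {p, q} ⊆ {p, q} from hall))
    rw [Set.encard_pair hpq] at h2
    norm_num at h2
  have hzp : z ≠ p := fun h => hzpq (Or.inl h)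
  have hzq : z ≠ q := fun h => hzpq (Or.inr h)
  have hpz : p ∈ G.span {q, z} := hG.1.mem_span_pair_exchange (Set.pair_comm p q ▸ hz) hzq
  refine ⟨insert z (B \ {p}), hB.exchange_base_of_notMem_closure hp ?_ (Set.mem_univ z), ?_, ?_⟩
  · rw [spanMatroid_closure]
    intro hzs
    have hqs : q ∈ B \ {p} := ⟨hq, hpq.symm⟩
    exact hB.indep p hp (span_pair_subset (isSubspace_span _) (subset_span _ hqs) hzs hpz)
  · rintro (h | h)
    · exact hzp h.symm
    · exact h.2 rfl
  · rintro S ⟨hS, hsep⟩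
    have hspan := span_inter_of_mem_baseSubset hB hS
    by_cases hpS : p ∈ (S : Set P)
    · have hqS : q ∈ (S : Set P) := by
        by_contra hqS
        exact hsep ⟨hS, hpS, hqS⟩
      refine ⟨insert z ((S ∩ B) \ {p}), Set.insert_subset_insert
        (Set.sdiff_subset_sdiff_left Set.inter_subset_right), Set.Subset.antisymm ?_ ?_⟩
      · refine span_subset S.2.1 (Set.insert_subset ?_
          (Set.sdiff_subset.trans Set.inter_subset_left))
        exact span_pair_subset S.2.1 hpS hqS hz
      · refine hspan.symm.subset.trans (span_subset (isSubspace_span _) fun x hx => ?_)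
        by_cases hxp : x = p
        · rw [hxp]
          have hqX : q ∈ insert z (((S : Set P) ∩ B) \ {p}) := Or.inr ⟨⟨hqS, hq⟩, hpq.symm⟩
          exact span_pair_subset (isSubspace_span _) (subset_span _ hqX)
            (subset_span _ (Set.mem_insert _ _)) hpz
        · exact subset_span _ (Or.inr ⟨hx, hxp⟩)
    · refine ⟨S ∩ B, fun x hx => Or.inr ⟨hx.2, ?_⟩, hspan⟩
      rintro rfl
      exact hpS hx.1

lemma ncard_eq_rank (hB : (spanMatroid hG).IsBase B) : B.ncard = rank hG Set.univ :=
  (rank_eq_ncard hB.isBasis_ground).symm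

variable [(spanMatroid hG).RankFinite]

lemma rank_eq_of_grassmann (hG : G.IsProjective) [(spanMatroid hG).RankFinite]
    (S : G.grassmann k) : rank hG S = k + 1 := (hasDim_iff.1 S.2).2

lemma hasDim_span {X : Set P} (hX : (spanMatroid hG).Indep X) (hk : X.ncard = k + 1) :
    G.HasDim (G.span X) k := hasDim_iff.2 ⟨isSubspace_span X, by rw [rank_span hX, hk]⟩

lemma ncard_inter_of_mem_baseSubset (hB : (spanMatroid hG).IsBase B) {S : G.grassmann k}
    (hS : S ∈ G.baseSubset k B) : ((S : Set P) ∩ B).ncard = k + 1 := by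
  rw [← rank_span (hB.indep.subset Set.inter_subset_right), span_inter_of_mem_baseSubset hB hS,
    rank_eq_of_grassmann]

lemma ncard_baseSubset (hB : (spanMatroid hG).IsBase B) :
    (G.baseSubset k B).ncard = (rank hG Set.univ).choose (k + 1) := by
  classical
  have hfin := hB.finite
  rw [← ncard_eq_rank hB, Set.ncard_eq_toFinset_card _ hfin, ← Finset.card_powersetCard,
    ← Set.ncard_coe_finset]
  have hmem : ∀ X ∈ (Finset.powersetCard (k + 1) hfin.toFinset : Set (Finset P)),
      (X : Set P) ⊆ B ∧ (X : Set P).ncard = k + 1 := by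
    intro X hX
    rw [Finset.mem_coe, Finset.mem_powersetCard] at hX
    exact ⟨fun x hx => hfin.mem_toFinset.1 (hX.1 hx), by rw [Set.ncard_coe_finset, hX.2]⟩
  symm
  refine Set.ncard_congr (fun X hX => ⟨G.span X, hasDim_span (hB.indep.subset (hmem X hX).1)
    (hmem X hX).2⟩) (fun X hX => ⟨X, (hmem X hX).1, rfl⟩) ?_ ?_
  · intro X Y hX hY hXY
    have hXY : G.span (X : Set P) = G.span (Y : Set P) := congrArg Subtype.val hXY
    rw [← Finset.coe_inj, ← span_inter_eq hB.indep (hmem X hX).1, hXY,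
      span_inter_eq hB.indep (hmem Y hY).1]
  · intro S hS
    have hSfin : ((S : Set P) ∩ B).Finite := hfin.subset Set.inter_subset_right
    refine ⟨hSfin.toFinset, ?_, Subtype.ext ?_⟩
    · rw [Finset.mem_coe, Finset.mem_powersetCard]
      refine ⟨fun x hx => hfin.mem_toFinset.2 (hSfin.mem_toFinset.1 hx).2, ?_⟩
      rw [← Set.ncard_eq_toFinset_card _ hSfin, ncard_inter_of_mem_baseSubset hB hS]
    · simp only [Set.Finite.coe_toFinset]
      exact span_inter_of_mem_baseSubset hB hS

lemma ncard_sepSubset (hB : (spanMatroid hG).IsBase B) {p q : P} (hp : p ∈ B) (hq : q ∈ B)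
    (hpq : p ≠ q) : (G.sepSubset k B p q).ncard = (rank hG Set.univ - 2).choose k := by
  classical
  have hfin : (B \ {p, q}).Finite := hB.finite.subset Set.sdiff_subset
  have hpqB : {p, q} ⊆ B := Set.insert_subset hp (Set.singleton_subset_iff.2 hq)
  rw [← ncard_eq_rank hB, ← Set.ncard_pair hpq, ← Set.ncard_sdiff hpqB,
    Set.ncard_eq_toFinset_card _ hfin, ← Finset.card_powersetCard, ← Set.ncard_coe_finset]
  have hmem : ∀ X ∈ (Finset.powersetCard k hfin.toFinset : Set (Finset P)),
      insert p (X : Set P) ⊆ B ∧ p ∉ X ∧ q ∉ X ∧ (insert p (X : Set P)).ncard = k + 1 := by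
    intro X hX
    rw [Finset.mem_coe, Finset.mem_powersetCard] at hX
    have hX1 : ∀ x ∈ X, x ∈ B \ {p, q} := fun x hx => hfin.mem_toFinset.1 (hX.1 hx)
    have hpX : p ∉ X := fun h => (hX1 p h).2 (Or.inl rfl)
    refine ⟨Set.insert_subset hp fun x hx => (hX1 x hx).1, hpX,
      fun h => (hX1 q h).2 (Or.inr rfl), ?_⟩
    rw [Set.ncard_insert_of_notMem hpX X.finite_toSet, Set.ncard_coe_finset, hX.2]
  symm
  refine Set.ncard_congr (fun X hX => ⟨G.span (insert p (X : Set P)),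
    hasDim_span (hB.indep.subset (hmem X hX).1) (hmem X hX).2.2.2⟩) ?_ ?_ ?_
  · intro X hX
    refine ⟨⟨_, (hmem X hX).1, rfl⟩, subset_span _ (Or.inl rfl), fun hqX => ?_⟩
    have hqX : q ∈ G.span (insert p (X : Set P)) ∩ B := ⟨hqX, hq⟩
    rw [span_inter_eq hB.indep (hmem X hX).1] at hqX
    exact hqX.elim (fun h => hpq h.symm) (hmem X hX).2.2.1
  · intro X Y hX hY hXY
    have hXY : G.span (insert p (X : Set P)) = G.span (insert p (Y : Set P)) :=
      congrArg Subtype.val hXY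
    have : insert p (X : Set P) = insert p (Y : Set P) := by
      rw [← span_inter_eq hB.indep (hmem X hX).1, hXY, span_inter_eq hB.indep (hmem Y hY).1]
    rw [← Finset.coe_inj, ← Set.insert_sdiff_self_of_notMem (a := p) (s := (X : Set P))
      (hmem X hX).2.1, this, Set.insert_sdiff_self_of_notMem (hmem Y hY).2.1]
  · rintro S ⟨hS, hpS, hqS⟩
    have hSfin : (((S : Set P) ∩ B) \ {p}).Finite :=
      hB.finite.subset (Set.sdiff_subset.trans Set.inter_subset_right)
    have hpSB : p ∈ (S : Set P) ∩ B := ⟨hpS, hp⟩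
    refine ⟨hSfin.toFinset, ?_, Subtype.ext ?_⟩
    · rw [Finset.mem_coe, Finset.mem_powersetCard]
      refine ⟨fun x hx => hfin.mem_toFinset.2 ?_, ?_⟩
      · have hx := hSfin.mem_toFinset.1 hx
        refine ⟨hx.1.2, ?_⟩
        rintro (h | h)
        · exact hx.2 h
        · exact hqS (h ▸ hx.1.1)
      · rw [← Set.ncard_eq_toFinset_card _ hSfin, Set.ncard_sdiff_singleton_of_mem hpSB,
          ncard_inter_of_mem_baseSubset hB hS]
        rfl
    · simp only [Set.Finite.coe_toFinset]
      rw [Set.insert_sdiff_self_of_mem hpSB]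
      exact span_inter_of_mem_baseSubset hB hS

lemma finite_baseSubset (hB : (spanMatroid hG).IsBase B)
    (hk : k + 1 ≤ rank hG Set.univ) : (G.baseSubset k B).Finite :=
  Set.finite_of_ncard_pos (by rw [ncard_baseSubset hB]; exact Nat.choose_pos hk)

/-- Some member of the base subset of `B` contains a given small part of `B` and avoids another. -/
lemma exists_mem_baseSubset (hB : (spanMatroid hG).IsBase B) {X Y : Set P} (hX : X ⊆ B)
    (hXY : Disjoint X Y) (hXk : X.ncard ≤ k + 1) (hYk : k + 1 + Y.ncard ≤ rank hG Set.univ)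
    (hY : Y.Finite) :
    ∃ S ∈ G.baseSubset k B, X ⊆ (S : Set P) ∧ ∀ y ∈ Y, y ∈ B → y ∉ (S : Set P) := by
  have hsub : X ⊆ B \ Y := fun x hx => ⟨hX hx, Set.disjoint_left.1 hXY hx⟩
  have hle : k + 1 ≤ (B \ Y).ncard := by
    have := Set.ncard_le_ncard_sdiff_add_ncard B Y hY
    rw [ncard_eq_rank hB] at this
    omega
  obtain ⟨Z, hXZ, hZB, hZ⟩ := Set.exists_subsuperset_card_eq hsub hXk hle
  have hZB' : Z ⊆ B := hZB.trans Set.sdiff_subset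
  refine ⟨⟨G.span Z, hasDim_span (hB.indep.subset hZB') hZ⟩, ⟨Z, hZB', rfl⟩,
    hXZ.trans (subset_span Z), fun y hy hyB hyZ => ?_⟩
  have hyZ : y ∈ G.span Z ∩ B := ⟨hyZ, hyB⟩
  rw [span_inter_eq hB.indep hZB'] at hyZ
  exact (hZB hyZ).2 hy

lemma sepSubset_injective (hB : (spanMatroid hG).IsBase B) (hk0 : 1 ≤ k)
    (hk : k + 3 ≤ rank hG Set.univ) {p q p₁ q₁ : P} (hp : p ∈ B) (hq : q ∈ B) (hpq : p ≠ q)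
    (hp₁ : p₁ ∈ B) (hq₁ : q₁ ∈ B)
    (he : G.sepSubset k B p q = G.sepSubset k B p₁ q₁) : p = p₁ ∧ q = q₁ := by
  have h1 : p = p₁ := by
    by_contra hne
    obtain ⟨S, hS, hpS, hSn⟩ := exists_mem_baseSubset (k := k) hB (X := {p}) (Y := {q, p₁})
      (Set.singleton_subset_iff.2 hp) (by simp [hpq, hne]) (by simp)
      (by have := Set.ncard_insert_le q {p₁}; rw [Set.ncard_singleton] at this; omega)
      (Set.toFinite _)
    have hmem : S ∈ G.sepSubset k B p q := ⟨hS, hpS rfl, hSn q (Or.inl rfl) hq⟩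
    rw [he] at hmem
    exact hSn p₁ (Or.inr rfl) hp₁ hmem.2.1
  refine ⟨h1, ?_⟩
  by_contra hne
  obtain ⟨S, hS, hpS, hSn⟩ := exists_mem_baseSubset (k := k) hB (X := {p, q₁}) (Y := {q})
    (Set.insert_subset hp (Set.singleton_subset_iff.2 hq₁))
    (by simp [hpq.symm, hne])
    (by have := Set.ncard_insert_le p {q₁}; rw [Set.ncard_singleton] at this; omega)
    (by rw [Set.ncard_singleton]; omega) (Set.toFinite _)
  have hmem : S ∈ G.sepSubset k B p q := ⟨hS, hpS (Or.inl rfl), hSn q rfl hq⟩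
  rw [he] at hmem
  exact hmem.2.2 (hpS (Or.inr rfl))

lemma baseSubset_injective {B₁ : Set P} (hB : (spanMatroid hG).IsBase B)
    (hB₁ : (spanMatroid hG).IsBase B₁) (hk : k + 2 ≤ rank hG Set.univ)
    (he : G.baseSubset k B = G.baseSubset k B₁) : B = B₁ := by
  refine hB.eq_of_subset_isBase hB₁ (subset_of_separating hB hB₁
    (by rw [ncard_eq_rank hB]; omega) subset_rfl he.subset fun p hp q hq hpq => ?_)
  obtain ⟨S, hS, hpS, hSn⟩ := exists_mem_baseSubset (k := k) hB (X := {p}) (Y := {q})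
    (Set.singleton_subset_iff.2 hp) (by simp [hpq]) (by simp)
    (by rw [Set.ncard_singleton]; omega) (Set.toFinite _)
  exact ⟨S, hS, hpS rfl, hSn q rfl hq⟩

/-- The number of ordered pairs of points of the base that both `S` and `T` separate depends only
on the rank of `S ∩ T`. -/
lemma ncard_separated_pairs (hB : (spanMatroid hG).IsBase B) {S T : G.grassmann k}
    (hS : S ∈ G.baseSubset k B) (hT : T ∈ G.baseSubset k B) :
    ∃ c, rank hG Set.univ + rank hG ((S : Set P) ∩ T) = c + 2 * (k + 1) ∧
      {x : P × P | x ∈ B.offDiag ∧ S ∈ G.sepSubset k B x.1 x.2 ∧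
        T ∈ G.sepSubset k B x.1 x.2}.ncard = rank hG ((S : Set P) ∩ T) * c := by
  have hfin := hB.finite
  have hrank : rank hG ((S : Set P) ∩ T) = (((S : Set P) ∩ B) ∩ ((T : Set P) ∩ B)).ncard := by
    conv_lhs => rw [← span_inter_of_mem_baseSubset hB hS, ← span_inter_of_mem_baseSubset hB hT,
      span_inter_span hB.indep Set.inter_subset_right Set.inter_subset_right]
    exact rank_span (hB.indep.subset (Set.inter_subset_left.trans Set.inter_subset_right))
  have hunion := Set.ncard_union_add_ncard_inter ((S : Set P) ∩ B) ((T : Set P) ∩ B)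
    (hfin.subset Set.inter_subset_right) (hfin.subset Set.inter_subset_right)
  rw [ncard_inter_of_mem_baseSubset hB hS, ncard_inter_of_mem_baseSubset hB hT, ← hrank] at hunion
  have hUB : ((S : Set P) ∩ B) ∪ ((T : Set P) ∩ B) ⊆ B :=
    Set.union_subset Set.inter_subset_right Set.inter_subset_right
  have hdiff := Set.ncard_sdiff_add_ncard_of_subset hUB hfin
  rw [ncard_eq_rank hB] at hdiff
  refine ⟨(B \ (((S : Set P) ∩ B) ∪ ((T : Set P) ∩ B))).ncard, by omega, ?_⟩
  rw [hrank, ← Set.ncard_prod]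
  congr 1
  ext ⟨p, q⟩
  constructor
  · rintro ⟨⟨hp, hq, -⟩, ⟨-, hpS, hqS⟩, -, hpT, hqT⟩
    exact ⟨⟨⟨hpS, hp⟩, hpT, hp⟩, hq, fun h => h.elim (fun h => hqS h.1) fun h => hqT h.1⟩
  · rintro ⟨⟨⟨hpS, hp⟩, hpT, -⟩, hq, hqn⟩
    have hqS : q ∉ (S : Set P) := fun h => hqn (Or.inl ⟨h, hq⟩)
    have hqT : q ∉ (T : Set P) := fun h => hqn (Or.inr ⟨h, hq⟩)
    exact ⟨⟨hp, hq, fun h : p = q => hqS (h ▸ hpS)⟩, ⟨hS, hpS, hqS⟩, hT, hpT, hqT⟩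

end

end PointLineSpace

/-! ### Maps preserving base subsets preserve adjacency -/

namespace PointLineSpace

variable {P P' : Type*} {G : PointLineSpace P} {G' : PointLineSpace P'} {N k : ℕ}

lemma rank_inter_le (hG : G.IsProjective) [(spanMatroid hG).RankFinite] {S T : G.grassmann k}
    (hne : S ≠ T) : rank hG ((S : Set P) ∩ T) ≤ k :=
  Nat.lt_succ_iff.1 <| (isGeometricRank hG).inf_rank_lt (m := k + 1)
    (x := ⟨⟨S, S.2.1⟩, rank_eq_of_grassmann hG S⟩) (y := ⟨⟨T, T.2.1⟩, rank_eq_of_grassmann hG T⟩)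
    fun h => hne (Subtype.ext (congrArg (fun x => (x.1 : Set P)) h))

/-- `f` maps the base subset of every base onto the base subset of some base. -/
def MapsBaseSubsets (hG : G.IsProjective) (hG' : G'.IsProjective)
    (f : G.grassmann k → G'.grassmann k) : Prop :=
  ∀ B, (spanMatroid hG).IsBase B →
    ∃ B', (spanMatroid hG').IsBase B' ∧ f '' G.baseSubset k B = G'.baseSubset k B'

namespace MapsBaseSubsets

variable {hG : G.IsProjective} {hG' : G'.IsProjective} [(spanMatroid hG).RankFinite]
  [(spanMatroid hG').RankFinite] {f : G.grassmann k → G'.grassmann k}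

/-- A base subset and its image have equally many elements, and any two subspaces lie in a common
base subset. -/
lemma injective (hf : MapsBaseSubsets hG hG' f) (hN : rank hG Set.univ = N)
    (hN' : rank hG' Set.univ = N) (hk : k + 1 ≤ N) : Function.Injective f := by
  intro S T hST
  obtain ⟨B, hB, hS, hT⟩ := exists_common_base hG S.2.1 T.2.1
  obtain ⟨B', hB', hBB'⟩ := hf B hB
  refine Set.injOn_of_ncard_image_eq ?_ (finite_baseSubset hB (by omega)) hS hT hST
  rw [hBB', ncard_baseSubset hB, ncard_baseSubset hB', hN, hN']

/-- Inexact subsets of a base subset, those lying in a second base subset, are mapped to inexact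
ones. As all complements of maximal inexact subsets have the same size, these complements are
mapped onto each other. -/
lemma exists_image_sepSubset (hf : MapsBaseSubsets hG hG' f) (hN : rank hG Set.univ = N)
    (hN' : rank hG' Set.univ = N) (hk0 : 1 ≤ k) (hk : k + 3 ≤ N) {B : Set P} {B' : Set P'}
    (hB : (spanMatroid hG).IsBase B) (hB' : (spanMatroid hG').IsBase B')
    (hBB' : f '' G.baseSubset k B = G'.baseSubset k B') {p q : P} (hp : p ∈ B) (hq : q ∈ B)
    (hpq : p ≠ q) : ∃ y ∈ B'.offDiag, f '' G.sepSubset k B p q = G'.sepSubset k B' y.1 y.2 := by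
  have hinj := hf.injective hN hN' (by omega)
  obtain ⟨B₁, hB₁, hpB₁, hsub⟩ :=
    exists_base_of_not_separating (k := k) hB (by rw [ncard_eq_rank hB]; omega) hp hq hpq
  obtain ⟨B₁', hB₁', hBB₁'⟩ := hf B₁ hB₁
  have hnsub : ¬ B' ⊆ B₁' := by
    intro h
    obtain rfl := hB'.eq_of_subset_isBase hB₁' h
    have := hinj.image_injective (hBB'.trans hBB₁'.symm)
    exact hpB₁ (baseSubset_injective hB hB₁ (by omega) this ▸ hp)
  have hR : f '' (G.baseSubset k B \ G.sepSubset k B p q) ⊆ G'.baseSubset k B' :=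
    hBB' ▸ Set.image_mono Set.sdiff_subset
  have hR₁ : f '' (G.baseSubset k B \ G.sepSubset k B p q) ⊆ G'.baseSubset k B₁' :=
    hBB₁' ▸ Set.image_mono hsub
  have hnsep := mt (subset_of_separating hB' hB₁' (by rw [ncard_eq_rank hB']; omega) hR hR₁) hnsub
  push Not at hnsep
  obtain ⟨p', hp', q', hq', hpq', hnot⟩ := hnsep
  refine ⟨(p', q'), ⟨hp', hq', hpq'⟩, ?_⟩
  have hincl : G'.sepSubset k B' p' q' ⊆ f '' G.sepSubset k B p q := by
    rintro S' ⟨hS', hpS', hqS'⟩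
    obtain ⟨S, hS, rfl⟩ : S' ∈ f '' G.baseSubset k B := hBB' ▸ hS'
    by_contra hmem
    exact hqS' (hnot _ ⟨S, ⟨hS, fun h => hmem ⟨S, h, rfl⟩⟩, rfl⟩ hpS')
  refine (Set.eq_of_subset_of_ncard_le hincl ?_ ?_).symm
  · rw [Set.ncard_image_of_injective _ hinj, ncard_sepSubset hB hp hq hpq,
      ncard_sepSubset hB' hp' hq' hpq', hN, hN']
  · exact ((finite_baseSubset hB (by omega)).subset (fun _ h => h.1)).image f

/-- The correspondence between complements of maximal inexact subsets is a bijection between the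
ordered pairs of points of two bases, so it preserves the number of pairs separated by two given
subspaces. -/
lemma ncard_separated_pairs_eq (hf : MapsBaseSubsets hG hG' f) (hN : rank hG Set.univ = N)
    (hN' : rank hG' Set.univ = N) (hk0 : 1 ≤ k) (hk : k + 3 ≤ N) {B : Set P} {B' : Set P'}
    (hB : (spanMatroid hG).IsBase B) (hB' : (spanMatroid hG').IsBase B')
    (hBB' : f '' G.baseSubset k B = G'.baseSubset k B') (S T : G.grassmann k) :
    {x : P × P | x ∈ B.offDiag ∧ S ∈ G.sepSubset k B x.1 x.2 ∧
      T ∈ G.sepSubset k B x.1 x.2}.ncard =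
    {x : P' × P' | x ∈ B'.offDiag ∧ f S ∈ G'.sepSubset k B' x.1 x.2 ∧
      f T ∈ G'.sepSubset k B' x.1 x.2}.ncard := by
  classical
  have hinj := hf.injective hN hN' (by omega)
  choose σ hσ hσf using fun x : B.offDiag =>
    hf.exists_image_sepSubset hN hN' hk0 hk hB hB' hBB' x.2.1 x.2.2.1 x.2.2.2
  let τ : B.offDiag → B'.offDiag := fun x => ⟨σ x, hσ x⟩
  have hτ : Function.Injective τ := by
    intro x y hxy
    have hxy : σ x = σ y := congrArg Subtype.val hxy
    have := hinj.image_injective ((hσf x).trans ((hxy ▸ rfl : _ = _).trans (hσf y).symm))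
    have h2 := sepSubset_injective hB hk0 (by omega) x.2.1 x.2.2.1 x.2.2.2 y.2.1 y.2.2.1 this
    exact Subtype.ext (Prod.ext h2.1 h2.2)
  have hcard : Nat.card B'.offDiag ≤ Nat.card B.offDiag := by
    rw [Nat.card_coe_set_eq, Nat.card_coe_set_eq,
      Set.ncard_eq_toFinset_card _ hB.finite.offDiag,
      Set.ncard_eq_toFinset_card _ hB'.finite.offDiag, Set.Finite.toFinset_offDiag hB.finite,
      Set.Finite.toFinset_offDiag hB'.finite, Finset.offDiag_card, Finset.offDiag_card,
      ← Set.ncard_eq_toFinset_card _ hB.finite, ← Set.ncard_eq_toFinset_card _ hB'.finite,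
      ncard_eq_rank hB, ncard_eq_rank hB', hN, hN']
  have : Finite B'.offDiag := hB'.finite.offDiag
  have hbij := hτ.bijective_of_nat_card_le hcard
  have hmem : ∀ (x : B.offDiag) (S : G.grassmann k),
      S ∈ G.sepSubset k B x.1.1 x.1.2 ↔ f S ∈ G'.sepSubset k B' (σ x).1 (σ x).2 := by
    intro x S
    rw [← hσf, hinj.mem_set_image]
  refine Set.ncard_congr (fun x hx => σ ⟨x, hx.1⟩) ?_ ?_ ?_
  · intro x hx
    exact ⟨hσ _, (hmem ⟨x, hx.1⟩ S).1 hx.2.1, (hmem ⟨x, hx.1⟩ T).1 hx.2.2⟩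
  · intro x y hx hy hxy
    exact congrArg Subtype.val (@hτ ⟨x, hx.1⟩ ⟨y, hy.1⟩ (Subtype.ext hxy))
  · rintro y ⟨hy, hyS, hyT⟩
    obtain ⟨x, hx⟩ := hbij.2 ⟨y, hy⟩
    have hx : σ x = y := congrArg Subtype.val hx
    refine ⟨x, ⟨x.2, ?_, ?_⟩, hx⟩
    · rw [hmem, hx]
      exact hyS
    · rw [hmem, hx]
      exact hyT

lemma rank_inter_eq_iff (hf : MapsBaseSubsets hG hG' f) (hN : rank hG Set.univ = N)
    (hN' : rank hG' Set.univ = N) (hk0 : 1 ≤ k) (hk : k + 3 ≤ N) (S T : G.grassmann k) :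
    rank hG ((S : Set P) ∩ T) = k ↔ rank hG' ((f S : Set P') ∩ f T) = k := by
  by_cases hST : S = T
  · subst hST
    rw [Set.inter_self, Set.inter_self, rank_eq_of_grassmann, rank_eq_of_grassmann]
  have hinj := hf.injective hN hN' (by omega)
  have h1 := rank_inter_le hG hST
  have h2 := rank_inter_le hG' (hinj.ne hST)
  obtain ⟨B, hB, hS, hT⟩ := exists_common_base hG S.2.1 T.2.1
  obtain ⟨B', hB', hBB'⟩ := hf B hB
  have hS' : f S ∈ G'.baseSubset k B' := hBB' ▸ ⟨S, hS, rfl⟩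
  have hT' : f T ∈ G'.baseSubset k B' := hBB' ▸ ⟨T, hT, rfl⟩
  have hcount := hf.ncard_separated_pairs_eq hN hN' hk0 hk hB hB' hBB' S T
  obtain ⟨c, hc, hcn⟩ := ncard_separated_pairs hB hS hT
  obtain ⟨c', hc', hcn'⟩ := ncard_separated_pairs hB' hS' hT'
  rw [hcn, hcn'] at hcount
  rw [hN] at hc
  rw [hN'] at hc'
  -- With `m = rank (S ∩ T) ≤ k` the count is `m * (N + m - 2 * (k + 1))`, whose maximum is
  -- attained for `m = k` only.
  have hmax : ∀ m m' c c' : ℕ, m ≤ k → m' ≤ k → N + m = c + 2 * (k + 1) →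
      N + m' = c' + 2 * (k + 1) → m * c = m' * c' → m = k → m' = k := by
    rintro m m' c c' - hm' hc hc' he rfl
    by_contra hne
    have hlt : m' < m := lt_of_le_of_ne hm' hne
    have h3 : m' * c' ≤ m * c' := Nat.mul_le_mul_right _ hm'
    have h4 : m * c' < m * c := Nat.mul_lt_mul_of_pos_left (by omega) (by omega)
    omega
  exact ⟨hmax _ _ _ _ h1 h2 hc hc' hcount, hmax _ _ _ _ h2 h1 hc' hc hcount.symm⟩

end MapsBaseSubsets

/-! ### Collineations -/

/-- The `k`-dimensional subspaces, as the elements of rank `k + 1` of the lattice of subspaces. -/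
def grassmannEquiv (hG : G.IsProjective) [(spanMatroid hG).RankFinite] (k : ℕ) :
    G.grassmann k ≃ RankLevel (fun S : G.Subspace => rank hG S) (k + 1) where
  toFun S := ⟨⟨S, S.2.1⟩, rank_eq_of_grassmann hG S⟩
  invFun S := ⟨S.1, hasDim_iff.2 ⟨S.1.2, S.2⟩⟩
  left_inv _ := rfl
  right_inv _ := rfl

lemma rank_singleton (hG : G.IsProjective) (p : P) : rank hG {p} = 1 := by
  have hind : (spanMatroid hG).Indep {p} := by
    rintro x rfl
    rw [Set.sdiff_self, isSubspace_empty.span_eq]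
    exact Set.notMem_empty _
  have := rank_span hind
  rwa [(isSubspace_singleton p).span_eq, Set.ncard_singleton] at this

/-- The points of a projective space, as the elements of rank one of its lattice of subspaces. -/
noncomputable def pointEquiv (hG : G.IsProjective) [(spanMatroid hG).RankFinite] :
    P ≃ RankLevel (fun S : G.Subspace => rank hG S) 1 :=
  Equiv.ofBijective (fun p => ⟨⟨{p}, isSubspace_singleton p⟩, rank_singleton hG p⟩)
    ⟨fun p q hpq => Set.singleton_injective (congrArg (fun x => (x.1 : Set P)) hpq), fun S => by
      have hne : (S.1 : Set P).Nonempty := by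
        rw [Set.nonempty_iff_ne_empty]
        intro h0
        have h1 : rank hG (S.1 : Set P) = 1 := S.2
        have h2 : rank hG ∅ = 0 := (isGeometricRank hG).rank_bot
        rw [h0, h2] at h1
        omega
      obtain ⟨p, hp⟩ := hne
      refine ⟨p, Subtype.ext ((isGeometricRank hG).eq_of_le (x := ⟨{p}, isSubspace_singleton p⟩)
        (Set.singleton_subset_iff.2 hp) ?_)⟩
      have h1 : rank hG (S.1 : Set P) = 1 := S.2
      simp only
      rw [h1, rank_singleton]⟩

lemma pointEquiv_le (hG : G.IsProjective) [(spanMatroid hG).RankFinite] (p : P) (S : G.Subspace) :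
    (pointEquiv hG p : G.Subspace) ≤ S ↔ p ∈ (S : Set P) :=
  Set.singleton_subset_iff

lemma mem_lines_iff (hG : G.IsProjective) [(spanMatroid hG).RankFinite] {L : Set P} :
    L ∈ G.lines ↔ G.IsSubspace L ∧ rank hG L = 2 := by
  have hpair : ∀ {p q : P}, p ≠ q → (spanMatroid hG).Indep {p, q} := by
    intro p q hpq
    have h := SpanIndep.insert hG (I := {q}) (x := p) (by
      rintro x rfl
      rw [Set.sdiff_self, isSubspace_empty.span_eq]
      exact Set.notMem_empty _) (by rwa [(isSubspace_singleton q).span_eq])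
    exact h
  constructor
  · intro hL
    obtain ⟨p, hp, q, hq, hpq⟩ := hG.1.line_nontrivial L hL
    rw [← hG.1.span_pair_eq_line hL hpq hp hq]
    exact ⟨isSubspace_span _, by rw [rank_span (hpair hpq), Set.ncard_pair hpq]⟩
  · rintro ⟨hL, hr⟩
    obtain ⟨I, hI⟩ := (spanMatroid hG).exists_isBasis L (Set.subset_univ _)
    rw [rank_eq_ncard hI] at hr
    obtain ⟨p, q, hpq, rfl⟩ := Set.ncard_eq_two.1 hr
    rw [← span_eq_of_isBasis hI hL]
    exact hG.1.span_pair_mem_lines hpq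

/-- The lines, as the elements of rank two of the lattice of subspaces. -/
def lineEquiv (hG : G.IsProjective) [(spanMatroid hG).RankFinite] :
    G.lines ≃ RankLevel (fun S : G.Subspace => rank hG S) 2 where
  toFun L := ⟨⟨L, ((mem_lines_iff hG).1 L.2).1⟩, ((mem_lines_iff hG).1 L.2).2⟩
  invFun S := ⟨S.1, (mem_lines_iff hG).2 ⟨S.1.2, S.2⟩⟩
  left_inv _ := rfl
  right_inv _ := rfl

/-- A bijection of points is a collineation if some map of lines, hitting exactly the lines,
is compatible with incidence. -/
lemma isCollineation_of_incidence {g : P → P'} (hg : Function.Bijective g)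
    (γ : G.lines → Set P') (hγ : Set.range γ = G'.lines)
    (hinc : ∀ p (L : G.lines), p ∈ (L : Set P) ↔ g p ∈ γ L) : G.IsCollineation G' g := by
  refine ⟨hg, ?_⟩
  rw [← hγ, Set.image_eq_range]
  congr 1
  ext L y
  obtain ⟨p, rfl⟩ := hg.2 y
  rw [hg.1.mem_set_image, hinc]

end PointLineSpace
open PointLineSpace

theorem corollary2p1 {P P' : Type*} (G : PointLineSpace P) (G' : PointLineSpace P') (n k : ℕ)
    (hG : G.IsProjective) (hG' : G'.IsProjective)
    (hn : G.HasDim Set.univ n) (hn' : G'.HasDim Set.univ n)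
    (hk0 : 0 < k) (hk : k < n - 1)
    (f : G.grassmann k → G'.grassmann k) (hf : Function.Surjective f)
    (hbase : ∀ 𝓑 : Set (G.grassmann k), G.IsBaseSubset k 𝓑 → G'.IsBaseSubset k (f '' 𝓑)) :
    (n ≠ 2 * k + 1 →
      ∃ g : P → P', G.IsCollineation G' g ∧ G.IsInducedBy G' k f g) ∧
    (n = 2 * k + 1 →
      (∃ g : P → P', G.IsCollineation G' g ∧ G.IsInducedBy G' k f g) ∨
      (∃ g : P → G'.grassmann (n - 1),
        G.IsCollineation (G'.dual n) g ∧ G.IsInducedByDual G' n k f g)) := by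
  have hfin := rankFinite_of_hasDim hG hn
  have hfin' := rankFinite_of_hasDim hG' hn'
  have hN : rank hG Set.univ = n + 1 := (hasDim_iff.1 hn).2
  have hN' : rank hG' Set.univ = n + 1 := (hasDim_iff.1 hn').2
  have hr := isGeometricRank hG
  have hr' := isGeometricRank hG'
  rw [hN] at hr
  rw [hN'] at hr'
  have hB : MapsBaseSubsets hG hG' f := by
    intro B hB
    obtain ⟨B', hB', he⟩ := hbase (G.baseSubset k B) ⟨B, (isBase_iff hG).2 hB, rfl⟩
    exact ⟨B', (isBase_iff hG').1 hB', he⟩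
  have hbij : Function.Bijective f := ⟨hB.injective hN hN' (by omega), hf⟩
  let F : grassmannGraph (fun S : G.Subspace => rank hG S) (k + 1) ≃g
      grassmannGraph (fun S : G'.Subspace => rank hG' S) (k + 1) :=
    { toEquiv := ((grassmannEquiv hG k).symm.trans (Equiv.ofBijective f hbij)).trans
        (grassmannEquiv hG' k)
      map_rel_iff' := by
        intro x y
        rw [hr.adj_iff_rank_inf, hr'.adj_iff_rank_inf, Nat.add_right_cancel_iff,
          Nat.add_right_cancel_iff]
        exact (hB.rank_inter_eq_iff hN hN' hk0 (by omega) ((grassmannEquiv hG k).symm x)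
          ((grassmannEquiv hG k).symm y)).symm }
  rcases chow hr hr' (by omega) (by omega) F with ⟨g₁, g₂, hl, hx⟩ | ⟨hnk, g₁, g₂, hl, hx⟩
  · have hind : ∃ g : P → P', G.IsCollineation G' g ∧ G.IsInducedBy G' k f g := by
      let e := ((pointEquiv hG).trans g₁).trans (pointEquiv hG').symm
      have he : ∀ p (S : G'.Subspace), e p ∈ (S : Set P') ↔
          (g₁ (pointEquiv hG p) : G'.Subspace) ≤ S := by
        intro p S
        rw [← pointEquiv_le hG']
        simp [e]
      refine ⟨e, isCollineation_of_incidence e.bijective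
        (fun L => ((g₂ (lineEquiv hG L) : G'.Subspace) : Set P')) ?_ ?_, ?_⟩
      · have h1 : Set.range (fun L : G'.lines => (L : Set P')) = G'.lines := Subtype.range_coe
        rw [← h1, ← (((lineEquiv hG).trans g₂).trans (lineEquiv hG').symm).surjective.range_comp]
        rfl
      · intro p L
        rw [he, ← hl, pointEquiv_le]
        rfl
      · intro S
        have himg : e '' (S : Set P) = f S := by
          ext y
          obtain ⟨p, rfl⟩ := e.surjective y
          rw [e.injective.mem_set_image]
          refine Iff.trans ?_ (he p ⟨f S, (f S).2.1⟩).symm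
          exact ((pointEquiv_le hG p ⟨S, S.2.1⟩).symm.trans
            (hx (pointEquiv hG p) (grassmannEquiv hG k S)))
        rw [himg, (f S).2.1.span_eq]
    exact ⟨fun _ => hind, fun _ => Or.inl hind⟩
  · refine ⟨fun hne => absurd (by omega) hne, fun _ => Or.inr ?_⟩
    let h : {x : G'.Subspace // rank hG' x + 1 = n + 1} ≃ G'.grassmann (n - 1) :=
      { toFun := fun x => ⟨x.1, hasDim_iff.2 ⟨x.1.2, by have := x.2; omega⟩⟩
        invFun := fun H => ⟨⟨H, H.2.1⟩, by
          have := rank_eq_of_grassmann hG' H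
          simp only
          omega⟩
        left_inv := fun _ => rfl
        right_inv := fun _ => rfl }
    let e := ((pointEquiv hG).trans g₁).trans h
    have he : ∀ p (S : G'.Subspace), (S : Set P') ⊆ (e p : Set P') ↔
        S ≤ (g₁ (pointEquiv hG p) : G'.Subspace) := fun _ _ => Iff.rfl
    refine ⟨e, isCollineation_of_incidence e.bijective
      (fun L => G'.hyperplanesThrough n ((g₂ (lineEquiv hG L) : G'.Subspace) : Set P')) ?_ ?_, ?_⟩
    · ext l
      constructor
      · rintro ⟨L, rfl⟩
        refine ⟨_, hasDim_iff.2 ⟨(g₂ (lineEquiv hG L)).1.2, ?_⟩, rfl⟩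
        have := (g₂ (lineEquiv hG L)).2
        omega
      · rintro ⟨U, hU, rfl⟩
        obtain ⟨hUs, hUr⟩ := (hasDim_iff (hG := hG')).1 hU
        obtain ⟨L, hL⟩ := ((lineEquiv hG).trans g₂).surjective
          ⟨⟨U, hUs⟩, by simp only; omega⟩
        refine ⟨L, ?_⟩
        have hL : g₂ (lineEquiv hG L) = _ := hL
        simp only [hL]
    · intro p L
      refine Iff.trans ?_ ((hl (pointEquiv hG p) (lineEquiv hG L)).trans (he p _).symm)
      exact (pointEquiv_le hG p (lineEquiv hG L)).symm
    · intro S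
      have himg : e '' (S : Set P) = G'.hyperplanesThrough n (f S : Set P') := by
        ext H
        obtain ⟨p, rfl⟩ := e.surjective H
        rw [e.injective.mem_set_image]
        refine Iff.trans ?_ (he p ⟨f S, (f S).2.1⟩).symm
        exact ((pointEquiv_le hG p ⟨S, S.2.1⟩).symm.trans
          (hx (pointEquiv hG p) (grassmannEquiv hG k S)))
      rw [himg]
      apply IsSubspace.span_eq
      -- Two distinct hyperplanes through `f S` meet in the axis of their pencil.
      rintro H₁ hH₁ H₂ hH₂ hne l ⟨U, hU, rfl⟩ hU₁ hU₂
      obtain ⟨hUs, hUr⟩ := (hasDim_iff (hG := hG')).1 hU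
      have hle := rank_inter_le hG' hne
      have hUeq := hr'.eq_of_le (x := ⟨U, hUs⟩) (y := ⟨_, H₁.2.1.inter H₂.2.1⟩)
        (Set.subset_inter hU₁ hU₂) (by simp only; omega)
      have hfU : (f S : Set P') ⊆ U := by
        rw [show U = (H₁ : Set P') ∩ H₂ from congrArg Subtype.val hUeq]
        exact Set.subset_inter hH₁ hH₂
      exact fun H hH => hfU.trans hH
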